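/- Throughout, $A$ is a complex Banach algebra (not necessarily unital), and in the operator space version $A$ is a completely contractive Banach algebra, i.e. it carries an operator space structure for which $\|[a_{ij}b_{kl}]\|\le\|[a_{ij}]\|\,\|[b_{kl}]\|$ for all matrices over $A$. The words "(operator)" and "(completely)" are read consistently, so the statement comprises a Banach space version and an operator space version; in the latter, dual spaces carry the dual operator space structure $M_n(V^*)=CB(V,M_n)$, and a bilinear map $B$ is completely contractive if $\|[B(v_{ij},w_{kl})]\|\le\|[v_{ij}]\|\,\|[w_{kl}]\|$. *Homogeneous left dual Banach algebras.* Let $\mathfrak A$ be a (completely contractive) Banach algebra with a fixed (operator space) predual $\mathfrak A_*$, so that $\mathfrak A=(\mathfrak A_*)^*$ (completely) isometrically. A pair $(\mathfrak A,\eta_{\mathfrak A})$ is an (operator) homogeneous left dual Banach algebra (HLDBA) over $A$ if (i) $\mu\mapsto\mu\nu$ is weak$^*$-continuous on $\mathfrak A$ for each $\nu\in\mathfrak A$; and (ii) $\eta_{\mathfrak A}:A\to\mathfrak A$ is a (completely) contractive homomorphism with weak$^*$-dense range and with values in the topological centre $Z_t(\mathfrak A)=\{\mu:\nu\mapsto\mu\nu\text{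 is weak}^*\text{-continuous on }\mathfrak A\}$. Two such pairs $(\mathfrak A,\eta_{\mathfrak A})$ and $(\mathfrak B,\eta_{\mathfrak B})$ are equivalent if there is a weak$^*$-continuous (completely) isometric algebra isomorphism $\Phi$ of $\mathfrak A$ onto $\mathfrak B$ with $\Phi\circ\eta_{\mathfrak A}=\eta_{\mathfrak B}$. *Homogeneous left Arens product algebras.* For $\phi\in A^*$ and $a\in A$ let $\langle\phi\cdot a,b\rangle=\langle\phi,ab\rangle$. An (operator) left introverted homogeneous subspace of $A^*$ is a linear subspace $\mathcal S(A^*)$ of $A^*$ with a complete norm (operator space matrix norm) $\|\cdot\|_{\mathcal S}$ such that (i) the embedding $\mathcal S(A^*)\hookrightarrow A^*$ is a (complete) contraction; (ii) $\phi\cdot a\in\mathcal S(A^*)$ for all $\phi\in\mathcal S(A^*)$, $a\in A$, and $(\phi,a)\mapsto\phi\cdot a$ is (completely) contractive for $\|\cdot\|_{\mathcal S}$; (iii) for $\mu\in\mathcal S(A^*)^*$ and $\phi\in\mathcal S(A^*)$ the functional $\mu\,\square\,\phi\in A^*$, $\langle\mu\,\square\,\phi,a\rangle=\langle\mu,\phi\cdot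 a\rangle$, belongs to $\mathcal S(A^*)$, and $(\mu,\phi)\mapsto\mu\,\square\,\phi$ is a (completely) contractive map $\mathcal S(A^*)^*\times\mathcal S(A^*)\to\mathcal S(A^*)$. The associated (operator) homogeneous left Arens product algebra is $\mathcal S(A^*)^*$ (the dual taken for $\|\cdot\|_{\mathcal S}$, with predual $\mathcal S(A^*)$) with the product $\langle\mu\,\square\,\nu,\phi\rangle=\langle\mu,\nu\,\square\,\phi\rangle$ and the map $\eta_{\mathcal S}:A\to\mathcal S(A^*)^*$, $\langle\eta_{\mathcal S}(a),\phi\rangle=\langle\phi,a\rangle$. **Theorem.** For every (operator) HLDBA $(\mathfrak A,\eta_{\mathfrak A})$ over $A$ there is a unique (operator) left introverted homogeneous subspace $(\mathcal S(A^*),\|\cdot\|_{\mathcal S})$ of $A^*$ such that $(\mathfrak A,\eta_{\mathfrak A})$ is equivalent to $(\mathcal S(A^*)^*,\eta_{\mathcal S})$. Here uniqueness refers to both the subspace and its norm (respectively its matrix norms). Moreover $\mathcal S(A^*)=\eta_{\mathfrak A}^*(\widehat{\mathfrak A_*})$, where $\widehat{\ }:\mathfrak A_*\to\mathfrak A^*$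 is the canonical embedding, and $\|\cdot\|_{\mathcal S}$ is the norm (matrix norm) transported from $\mathfrak A_*$: $\|\eta_{\mathfrak A}^*(\widehat\psi)\|_{\mathcal S}=\|\psi\|$ for $\psi\in\mathfrak A_*$ (respectively $\|[\eta_{\mathfrak A}^*(\widehat{\psi_{ij}})]\|_{\mathcal S}=\|[\psi_{ij}]\|$ for $[\psi_{ij}]\in M_n(\mathfrak A_*)$, $n\in\mathbb N$). -/

import Mathlib

/-! ### Operator spaces -/

section OperatorSpaces

open scoped Matrix.Norms.L2Operator

/-- A family of real-valued functions on the matrix spaces `M_n(V)`, `n ∈ ℕ`. -/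
abbrev MatrixNormFamily (V : Type*) := (n : ℕ) → Matrix (Fin n) (Fin n) V → ℝ

/-- The product `α v β` of a matrix `v ∈ M_m(V)` with scalar matrices `α ∈ M_{n,m}` and
`β ∈ M_{m,n}`. -/
def scalarTwoSided {V : Type*} [AddCommGroup V] [Module ℂ V] {m n : ℕ}
    (α : Matrix (Fin n) (Fin m) ℂ) (v : Matrix (Fin m) (Fin m) V)
    (β : Matrix (Fin m) (Fin n) ℂ) : Matrix (Fin n) (Fin n) V :=
  Matrix.of fun i j => ∑ k, ∑ l, (α i k * β l j) • v k l

/-- The block diagonal matrix `v ⊕ w ∈ M_{m+n}(V)`. -/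
def matrixDirectSum {V : Type*} [AddCommGroup V] {m n : ℕ}
    (v : Matrix (Fin m) (Fin m) V) (w : Matrix (Fin n) (Fin n) V) :
    Matrix (Fin (m + n)) (Fin (m + n)) V :=
  Matrix.reindex finSumFinEquiv finSumFinEquiv (Matrix.fromBlocks v 0 0 w)

/-- An (abstract) operator space structure on a normed space `V`: a norm on every `M_n(V)`
which satisfies Ruan's axioms and extends the given norm of `V = M_1(V)`. Scalar matrices carry
the operator norm on Euclidean spaces. (Definiteness at every level follows from `norm_one` and
`two_sided_le`.) -/
structure OperatorSpaceStructure (V : Type*) [NormedAddCommGroup V] [NormedSpace ℂ V] where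
  mnorm : (n : ℕ) → Seminorm ℂ (Matrix (Fin n) (Fin n) V)
  norm_one : ∀ v : V, mnorm 1 (Matrix.of fun _ _ => v) = ‖v‖
  direct_sum : ∀ (m n : ℕ) (v : Matrix (Fin m) (Fin m) V) (w : Matrix (Fin n) (Fin n) V),
    mnorm (m + n) (matrixDirectSum v w) = max (mnorm m v) (mnorm n w)
  two_sided_le : ∀ (m n : ℕ) (α : Matrix (Fin n) (Fin m) ℂ) (v : Matrix (Fin m) (Fin m) V)
    (β : Matrix (Fin m) (Fin n) ℂ),
    mnorm n (scalarTwoSided α v β) ≤ ‖α‖ * mnorm m v * ‖β‖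

/-- The matrix norms of an operator space, as a family of functions. -/
noncomputable def OperatorSpaceStructure.norms {V : Type*} [NormedAddCommGroup V] [NormedSpace ℂ V]
    (O : OperatorSpaceStructure V) : MatrixNormFamily V :=
  fun n v => O.mnorm n v

/-- The dual operator space matrix norms, `M_n(V^*) = CB(V, M_n)`: the norm of `f = [f_ij]` is the
completely bounded norm of `v ↦ [f_ij(v)]`, i.e. the least `C ≥ 0` such that the operator norm of
`[f_ij(v_kl)] ∈ M_{nm}` is at most `C ‖v‖` for all `m` and `v ∈ M_m(V)`. -/
noncomputable def dualNorms {V : Type*} [NormedAddCommGroup V] [NormedSpace ℂ V]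
    (N : MatrixNormFamily V) : MatrixNormFamily (StrongDual ℂ V) :=
  fun n f => sInf {C : ℝ | 0 ≤ C ∧ ∀ (m : ℕ) (v : Matrix (Fin m) (Fin m) V),
    ‖(Matrix.of fun p q : Fin n × Fin m => f p.1 q.1 (v p.2 q.2) :
      Matrix (Fin n × Fin m) (Fin n × Fin m) ℂ)‖ ≤ C * N m v}

end OperatorSpaces

/-- `T` is a complete contraction. -/
def IsCompleteContraction {V W : Type*} (N : MatrixNormFamily V) (N' : MatrixNormFamily W)
    (T : V → W) : Prop :=
  ∀ (n : ℕ) (v : Matrix (Fin n) (Fin n) V), N' n (v.map T) ≤ N n v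

/-- `T` is a complete isometry. -/
def IsCompleteIsometry {V W : Type*} (N : MatrixNormFamily V) (N' : MatrixNormFamily W)
    (T : V → W) : Prop :=
  ∀ (n : ℕ) (v : Matrix (Fin n) (Fin n) V), N' n (v.map T) = N n v

/-- A bilinear map `B` is completely contractive: `‖[B(v_ij, w_kl)]‖_{pq} ≤ ‖v‖_p ‖w‖_q` for all
`v ∈ M_p(V)` and `w ∈ M_q(W)`. -/
def IsCompleteContraction₂ {V W X : Type*} (N : MatrixNormFamily V) (N' : MatrixNormFamily W)
    (N'' : MatrixNormFamily X) (B : V → W → X) : Prop :=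
  ∀ (p q : ℕ) (v : Matrix (Fin p) (Fin p) V) (w : Matrix (Fin q) (Fin q) W),
    N'' (p * q) (Matrix.reindex finProdFinEquiv finProdFinEquiv
      (Matrix.of fun s t : Fin p × Fin q => B (v s.1 t.1) (w s.2 t.2))) ≤ N p v * N' q w

/-- A Banach algebra with an operator space structure is a completely contractive Banach algebra
when its multiplication is completely contractive. -/
def IsCCBanachAlgebra {A : Type*} [NonUnitalNormedRing A] [NormedSpace ℂ A]
    (O : OperatorSpaceStructure A) : Prop :=
  IsCompleteContraction₂ O.norms O.norms O.norms fun a b : A => a * b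

/-! ### Homogeneous left dual Banach algebras -/

section HLDBA

/-- The weak* topology of a space `E` that is identified with the dual of `P` through `j`. -/
@[reducible] noncomputable def weakStarTopology {E P : Type*} [NormedAddCommGroup E] [NormedSpace ℂ E]
    [NormedAddCommGroup P] [NormedSpace ℂ P] (j : E ≃ₗᵢ[ℂ] StrongDual ℂ P) :
    TopologicalSpace E :=
  TopologicalSpace.induced (fun x => StrongDual.toWeakDual (j x)) inferInstance

/-- `f` is weak*-weak* continuous. -/
def IsWeakStarContinuous {E P F Q : Type*} [NormedAddCommGroup E] [NormedSpace ℂ E]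
    [NormedAddCommGroup P] [NormedSpace ℂ P] [NormedAddCommGroup F] [NormedSpace ℂ F]
    [NormedAddCommGroup Q] [NormedSpace ℂ Q] (j : E ≃ₗᵢ[ℂ] StrongDual ℂ P)
    (k : F ≃ₗᵢ[ℂ] StrongDual ℂ Q) (f : E → F) : Prop :=
  @Continuous E F (weakStarTopology j) (weakStarTopology k) f

/-- The topological centre `Z_t(𝔄)`. -/
def topologicalCentre {𝔄 P : Type*} [NonUnitalNormedRing 𝔄] [NormedSpace ℂ 𝔄]
    [NormedAddCommGroup P] [NormedSpace ℂ P] (j : 𝔄 ≃ₗᵢ[ℂ] StrongDual ℂ P) : Set 𝔄 :=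
  {μ | IsWeakStarContinuous j j fun ν => μ * ν}

/-- `(𝔄, η)` is a homogeneous left dual Banach algebra over `A`, where the Banach algebra `𝔄` has
the fixed predual `P` through the isometric isomorphism `j : 𝔄 ≃ P^*`. -/
structure IsHLDBA {A 𝔄 P : Type*} [NonUnitalNormedRing A] [NormedSpace ℂ A]
    [NonUnitalNormedRing 𝔄] [NormedSpace ℂ 𝔄] [NormedAddCommGroup P] [NormedSpace ℂ P]
    (j : 𝔄 ≃ₗᵢ[ℂ] StrongDual ℂ P) (η : A →L[ℂ] 𝔄) : Prop where
  mul_right_continuous : ∀ ν : 𝔄, IsWeakStarContinuous j j fun μ => μ * ν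
  map_mul : ∀ a b : A, η (a * b) = η a * η b
  contractive : ∀ a : A, ‖η a‖ ≤ ‖a‖
  mem_centre : ∀ a : A, η a ∈ topologicalCentre j
  dense_range : @DenseRange 𝔄 (weakStarTopology j) A η

/-- `(𝔄, η)` is an operator homogeneous left dual Banach algebra over the completely contractive
Banach algebra `(A, OA)`, where `𝔄` has the operator space predual `(P, OP)`. -/
structure IsOperatorHLDBA {A 𝔄 P : Type*} [NonUnitalNormedRing A] [NormedSpace ℂ A]
    [NonUnitalNormedRing 𝔄] [NormedSpace ℂ 𝔄] [NormedAddCommGroup P] [NormedSpace ℂ P]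
    (OA : OperatorSpaceStructure A) (O𝔄 : OperatorSpaceStructure 𝔄)
    (OP : OperatorSpaceStructure P)
    (j : 𝔄 ≃ₗᵢ[ℂ] StrongDual ℂ P) (η : A →L[ℂ] 𝔄) : Prop extends IsHLDBA j η where
  cc_algebra : IsCCBanachAlgebra O𝔄
  predual : IsCompleteIsometry O𝔄.norms (dualNorms OP.norms) j
  completely_contractive : IsCompleteContraction OA.norms O𝔄.norms η

/-- Equivalence of homogeneous left dual Banach algebras over `A`: there is a weak*-continuous
isometric algebra isomorphism `Φ` of `𝔄` onto `𝔅` with `Φ ∘ η = θ`. -/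
def HLDBAEquivalent {A 𝔄 P 𝔅 Q : Type*} [NonUnitalNormedRing A] [NormedSpace ℂ A]
    [NonUnitalNormedRing 𝔄] [NormedSpace ℂ 𝔄] [NormedAddCommGroup P] [NormedSpace ℂ P]
    [NonUnitalNormedRing 𝔅] [NormedSpace ℂ 𝔅] [NormedAddCommGroup Q] [NormedSpace ℂ Q]
    (j : 𝔄 ≃ₗᵢ[ℂ] StrongDual ℂ P) (η : A →L[ℂ] 𝔄)
    (k : 𝔅 ≃ₗᵢ[ℂ] StrongDual ℂ Q) (θ : A →L[ℂ] 𝔅) : Prop :=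
  ∃ Φ : 𝔄 ≃ₗᵢ[ℂ] 𝔅, (∀ μ ν : 𝔄, Φ (μ * ν) = Φ μ * Φ ν) ∧
    IsWeakStarContinuous j k Φ ∧ ∀ a : A, Φ (η a) = θ a

/-- Equivalence of operator homogeneous left dual Banach algebras over `A`: as before, with a
completely isometric `Φ`. -/
def OperatorHLDBAEquivalent {A 𝔄 P 𝔅 Q : Type*} [NonUnitalNormedRing A] [NormedSpace ℂ A]
    [NonUnitalNormedRing 𝔄] [NormedSpace ℂ 𝔄] [NormedAddCommGroup P] [NormedSpace ℂ P]
    [NonUnitalNormedRing 𝔅] [NormedSpace ℂ 𝔅] [NormedAddCommGroup Q] [NormedSpace ℂ Q]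
    (N𝔄 : MatrixNormFamily 𝔄) (j : 𝔄 ≃ₗᵢ[ℂ] StrongDual ℂ P) (η : A →L[ℂ] 𝔄)
    (N𝔅 : MatrixNormFamily 𝔅) (k : 𝔅 ≃ₗᵢ[ℂ] StrongDual ℂ Q) (θ : A →L[ℂ] 𝔅) : Prop :=
  ∃ Φ : 𝔄 ≃ₗᵢ[ℂ] 𝔅, (∀ μ ν : 𝔄, Φ (μ * ν) = Φ μ * Φ ν) ∧
    IsWeakStarContinuous j k Φ ∧ (∀ a : A, Φ (η a) = θ a) ∧ IsCompleteIsometry N𝔄 N𝔅 Φ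

/-- The map `P → A^*`, `ψ ↦ η^*(ψ̂)`, where `ψ̂` is `ψ` viewed as a functional on `𝔄 = P^*`. -/
noncomputable def predualPullback {A 𝔄 P : Type*} [NonUnitalNormedRing A] [NormedSpace ℂ A]
    [NonUnitalNormedRing 𝔄] [NormedSpace ℂ 𝔄] [NormedAddCommGroup P] [NormedSpace ℂ P]
    (j : 𝔄 ≃ₗᵢ[ℂ] StrongDual ℂ P) (η : A →L[ℂ] 𝔄) : P →ₗ[ℂ] StrongDual ℂ A where
  toFun ψ := ((NormedSpace.inclusionInDoubleDual ℂ P ψ).comp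
    (j.toContinuousLinearEquiv : 𝔄 →L[ℂ] StrongDual ℂ P)).comp η
  map_add' _ _ := by ext; simp
  map_smul' _ _ := by ext; simp

end HLDBA

/-! ### Left introverted homogeneous subspaces of `A^*` -/

/-- A linear subspace of `E` with a norm of its own. -/
structure NormedSubspace (E : Type*) [AddCommGroup E] [Module ℂ E] where
  carrier : Submodule ℂ E
  nrm : Seminorm ℂ carrier
  eq_zero_of_nrm : ∀ φ : carrier, nrm φ = 0 → φ = 0

namespace NormedSubspace

variable {E : Type*} [AddCommGroup E] [Module ℂ E]

/-- The subspace as a normed space with its own norm (not the norm induced from `E`). -/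
def Space (S : NormedSubspace E) : Type _ := S.carrier

noncomputable instance (S : NormedSubspace E) : NormedAddCommGroup S.Space :=
  AddGroupNorm.toNormedAddCommGroup (E := S.carrier)
    { S.nrm.toAddGroupSeminorm with eq_zero_of_map_eq_zero' := S.eq_zero_of_nrm }

instance (S : NormedSubspace E) : Module ℂ S.Space := inferInstanceAs (Module ℂ S.carrier)

noncomputable instance (S : NormedSubspace E) : NormedSpace ℂ S.Space where
  norm_smul_le c φ := (map_smul_eq_mul S.nrm c φ).le

/-- The embedding of the subspace. -/
def incl (S : NormedSubspace E) : S.Space →ₗ[ℂ] E := S.carrier.subtype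

/-- An element of the subspace. -/
def elt (S : NormedSubspace E) (φ : E) (h : φ ∈ S.carrier) : S.Space := ⟨φ, h⟩

@[simp] theorem incl_elt (S : NormedSubspace E) (φ : E) (h : φ ∈ S.carrier) :
    S.incl (S.elt φ h) = φ := rfl

theorem incl_mem (S : NormedSubspace E) (φ : S.Space) : S.incl φ ∈ S.carrier := Subtype.property φ

theorem incl_injective (S : NormedSubspace E) : Function.Injective S.incl := Subtype.val_injective

end NormedSubspace

section Introverted

variable {A : Type*} [NonUnitalNormedRing A] [NormedSpace ℂ A] [IsScalarTower ℂ A A]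
  [SMulCommClass ℂ A A]

/-- The right module action of `A` on `A^*`: `⟨φ · a, b⟩ = ⟨φ, a b⟩`. -/
noncomputable def dualAct (φ : StrongDual ℂ A) (a : A) : StrongDual ℂ A :=
  φ.comp (ContinuousLinearMap.mul ℂ A a)

@[simp] theorem dualAct_apply (φ : StrongDual ℂ A) (a b : A) : dualAct φ a b = φ (a * b) := rfl

end Introverted

/-- A left homogeneous subspace of `A^*`: a subspace with a complete norm such that the embedding
into `A^*` is a contraction and the subspace is a contractive right `A`-module. -/
structure LeftHomogeneousSubspace (A : Type*) [NonUnitalNormedRing A] [NormedSpace ℂ A]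
    [IsScalarTower ℂ A A] [SMulCommClass ℂ A A] extends NormedSubspace (StrongDual ℂ A) where
  complete : CompleteSpace toNormedSubspace.Space
  norm_incl_le : ∀ φ : toNormedSubspace.Space, ‖toNormedSubspace.incl φ‖ ≤ ‖φ‖
  act_mem : ∀ (φ : toNormedSubspace.Space) (a : A), dualAct (toNormedSubspace.incl φ) a ∈ carrier
  norm_act_le : ∀ (φ : toNormedSubspace.Space) (a : A),
    ‖toNormedSubspace.elt (dualAct (toNormedSubspace.incl φ) a) (act_mem φ a)‖ ≤ ‖φ‖ * ‖a‖

namespace LeftHomogeneousSubspace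

variable {A : Type*} [NonUnitalNormedRing A] [NormedSpace ℂ A] [IsScalarTower ℂ A A]
  [SMulCommClass ℂ A A]

/-- The module action `S(A^*) × A → S(A^*)`, `(φ, a) ↦ φ · a`. -/
noncomputable def act (S : LeftHomogeneousSubspace A) (φ : S.Space) (a : A) : S.Space :=
  S.elt (dualAct (S.incl φ) a) (S.act_mem φ a)

@[simp] theorem incl_act (S : LeftHomogeneousSubspace A) (φ : S.Space) (a : A) :
    S.incl (S.act φ a) = dualAct (S.incl φ) a := rfl

theorem act_add (S : LeftHomogeneousSubspace A) (φ : S.Space) (a b : A) :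
    S.act φ (a + b) = S.act φ a + S.act φ b := by
  apply S.incl_injective
  ext c
  simp [add_mul]

theorem act_smul (S : LeftHomogeneousSubspace A) (φ : S.Space) (c : ℂ) (a : A) :
    S.act φ (c • a) = c • S.act φ a := by
  apply S.incl_injective
  ext b
  simp [smul_mul_assoc]

theorem add_act (S : LeftHomogeneousSubspace A) (φ ψ : S.Space) (a : A) :
    S.act (φ + ψ) a = S.act φ a + S.act ψ a := by
  apply S.incl_injective
  ext c
  simp

theorem smul_act (S : LeftHomogeneousSubspace A) (c : ℂ) (φ : S.Space) (a : A) :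
    S.act (c • φ) a = c • S.act φ a := by
  apply S.incl_injective
  ext b
  simp

/-- The map `S(A^*)^* × S(A^*) → A^*`, `(μ, φ) ↦ μ □ φ`, with `⟨μ □ φ, a⟩ = ⟨μ, φ · a⟩`. -/
noncomputable def arensAct (S : LeftHomogeneousSubspace A) (μ : StrongDual ℂ S.Space)
    (φ : S.Space) : StrongDual ℂ A :=
  LinearMap.mkContinuous
    { toFun := fun a => μ (S.act φ a)
      map_add' := fun a b => by rw [act_add, map_add]
      map_smul' := fun c a => by rw [act_smul, map_smul]; rfl }
    (‖μ‖ * ‖φ‖) fun a => by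
      rw [mul_assoc]
      exact (μ.le_opNorm _).trans
        (mul_le_mul_of_nonneg_left (S.norm_act_le φ a) (norm_nonneg μ))

@[simp] theorem arensAct_apply (S : LeftHomogeneousSubspace A) (μ : StrongDual ℂ S.Space)
    (φ : S.Space) (a : A) : S.arensAct μ φ a = μ (S.act φ a) := rfl

end LeftHomogeneousSubspace

/-- A left introverted homogeneous subspace of `A^*`: `(μ, φ) ↦ μ □ φ` is a contractive map
`S(A^*)^* × S(A^*) → S(A^*)`. -/
structure LeftIntrovertedSubspace (A : Type*) [NonUnitalNormedRing A] [NormedSpace ℂ A]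
    [IsScalarTower ℂ A A] [SMulCommClass ℂ A A] extends LeftHomogeneousSubspace A where
  arensAct_mem : ∀ (μ : StrongDual ℂ toNormedSubspace.Space) (φ : toNormedSubspace.Space),
    toLeftHomogeneousSubspace.arensAct μ φ ∈ carrier
  norm_arensAct_le : ∀ (μ : StrongDual ℂ toNormedSubspace.Space) (φ : toNormedSubspace.Space),
    ‖toNormedSubspace.elt (toLeftHomogeneousSubspace.arensAct μ φ) (arensAct_mem μ φ)‖
      ≤ ‖μ‖ * ‖φ‖

namespace LeftIntrovertedSubspace

variable {A : Type*} [NonUnitalNormedRing A] [NormedSpace ℂ A] [IsScalarTower ℂ A A]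
  [SMulCommClass ℂ A A]

/-- The map `S(A^*)^* × S(A^*) → S(A^*)`, `(μ, φ) ↦ μ □ φ`. -/
noncomputable def box (S : LeftIntrovertedSubspace A) (μ : StrongDual ℂ S.Space)
    (φ : S.Space) : S.Space :=
  S.elt (S.arensAct μ φ) (S.arensAct_mem μ φ)

@[simp] theorem incl_box_apply (S : LeftIntrovertedSubspace A) (μ : StrongDual ℂ S.Space)
    (φ : S.Space) (a : A) : S.incl (S.box μ φ) a = μ (S.act φ a) := rfl

/-- The first Arens product on `S(A^*)^*`: `⟨μ □ ν, φ⟩ = ⟨μ, ν □ φ⟩`. -/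
noncomputable def arensMul (S : LeftIntrovertedSubspace A) (μ ν : StrongDual ℂ S.Space) :
    StrongDual ℂ S.Space :=
  LinearMap.mkContinuous
    { toFun := fun φ => μ (S.box ν φ)
      map_add' := fun φ ψ => by
        rw [← map_add]
        congr 1
        apply S.incl_injective
        ext a
        simp [S.add_act]
      map_smul' := fun c φ => by
        rw [RingHom.id_apply, ← map_smul]
        congr 1
        apply S.incl_injective
        ext a
        simp [S.smul_act] }
    (‖μ‖ * ‖ν‖) fun φ => by
      rw [mul_assoc]
      exact (μ.le_opNorm _).trans
        (mul_le_mul_of_nonneg_left (S.norm_arensAct_le ν φ) (norm_nonneg μ))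

@[simp] theorem arensMul_apply (S : LeftIntrovertedSubspace A) (μ ν : StrongDual ℂ S.Space)
    (φ : S.Space) : S.arensMul μ ν φ = μ (S.box ν φ) := rfl

theorem norm_arensMul_le (S : LeftIntrovertedSubspace A) (μ ν : StrongDual ℂ S.Space) :
    ‖S.arensMul μ ν‖ ≤ ‖μ‖ * ‖ν‖ := by
  unfold arensMul
  exact LinearMap.mkContinuous_norm_le _ (mul_nonneg (norm_nonneg μ) (norm_nonneg ν)) _

/-- The homogeneous left Arens product algebra `(S(A^*)^*, □)`: the dual Banach space of
`S(A^*)`, with the first Arens product as multiplication. -/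
def ArensAlgebra (S : LeftIntrovertedSubspace A) : Type _ := StrongDual ℂ S.Space

noncomputable instance (S : LeftIntrovertedSubspace A) : NormedAddCommGroup S.ArensAlgebra :=
  inferInstanceAs (NormedAddCommGroup (StrongDual ℂ S.Space))

noncomputable instance (S : LeftIntrovertedSubspace A) : NonUnitalNormedRing S.ArensAlgebra where
  __ := (inferInstance : NormedAddCommGroup S.ArensAlgebra)
  mul := S.arensMul
  left_distrib μ ν ξ := by
    apply ContinuousLinearMap.ext
    intro φ
    refine Eq.trans ?_ (map_add (show StrongDual ℂ S.Space from μ) (S.box ν φ) (S.box ξ φ))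
    refine congrArg (show StrongDual ℂ S.Space from μ) ?_
    apply S.incl_injective
    ext a
    rfl
  right_distrib _ _ _ := rfl
  zero_mul _ := rfl
  mul_zero μ := by
    apply ContinuousLinearMap.ext
    intro φ
    refine Eq.trans ?_ (map_zero (show StrongDual ℂ S.Space from μ))
    refine congrArg (show StrongDual ℂ S.Space from μ) ?_
    apply S.incl_injective
    ext a
    rfl
  mul_assoc μ ν ξ := by
    apply ContinuousLinearMap.ext
    intro φ
    refine congrArg (show StrongDual ℂ S.Space from μ) ?_
    apply S.incl_injective
    ext a
    refine congrArg (show StrongDual ℂ S.Space from ν) ?_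
    apply S.incl_injective
    ext b
    refine congrArg (show StrongDual ℂ S.Space from ξ) ?_
    apply S.incl_injective
    ext c
    simp [mul_assoc]
  norm_mul_le μ ν := S.norm_arensMul_le μ ν

noncomputable instance (S : LeftIntrovertedSubspace A) : NormedSpace ℂ S.ArensAlgebra :=
  inferInstanceAs (NormedSpace ℂ (StrongDual ℂ S.Space))

/-- The predual of `S(A^*)^*` is `S(A^*)`. -/
noncomputable def predual (S : LeftIntrovertedSubspace A) :
    S.ArensAlgebra ≃ₗᵢ[ℂ] StrongDual ℂ S.Space :=
  LinearIsometryEquiv.refl ℂ (StrongDual ℂ S.Space)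

theorem predual_mul (S : LeftIntrovertedSubspace A) (μ ν : S.ArensAlgebra) (φ : S.Space) :
    S.predual (μ * ν) φ = S.predual μ (S.box (S.predual ν) φ) := rfl

instance (S : LeftIntrovertedSubspace A) : CompleteSpace S.ArensAlgebra :=
  inferInstanceAs (CompleteSpace (StrongDual ℂ S.Space))

instance (S : LeftIntrovertedSubspace A) : IsScalarTower ℂ S.ArensAlgebra S.ArensAlgebra where
  smul_assoc _ _ _ := rfl

instance (S : LeftIntrovertedSubspace A) : SMulCommClass ℂ S.ArensAlgebra S.ArensAlgebra where
  smul_comm c μ ν := by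
    apply ContinuousLinearMap.ext
    intro φ
    refine Eq.trans (map_smul (show StrongDual ℂ S.Space from μ) c (S.box ν φ)).symm ?_
    refine congrArg (show StrongDual ℂ S.Space from μ) ?_
    apply S.incl_injective
    ext a
    rfl

/-- The contractive embedding `S(A^*) → A^*` as a continuous linear map. -/
noncomputable def inclCLM (S : LeftIntrovertedSubspace A) : S.Space →L[ℂ] StrongDual ℂ A :=
  S.incl.mkContinuous 1 fun φ => by
    rw [one_mul]
    exact S.norm_incl_le φ

/-- The map `η_S : A → S(A^*)^*`, `⟨η_S(a), φ⟩ = ⟨φ, a⟩`. -/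
noncomputable def eta (S : LeftIntrovertedSubspace A) : A →L[ℂ] S.ArensAlgebra :=
  (S.predual.symm.toContinuousLinearEquiv : StrongDual ℂ S.Space →L[ℂ] S.ArensAlgebra).comp
    S.inclCLM.flip

theorem predual_eta (S : LeftIntrovertedSubspace A) (a : A) (φ : S.Space) :
    S.predual (S.eta a) φ = S.incl φ a := rfl

end LeftIntrovertedSubspace

/-- An operator left introverted homogeneous subspace of `A^*`, for a completely contractive Banach
algebra `(A, OA)`. The norm of the subspace is the first one of the matrix norms (`OS.norm_one`), so
the conditions without matrices, which come with `LeftIntrovertedSubspace`, are the case of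
`1 × 1` matrices of the conditions below. The space `A^*` and the dual of the
subspace carry the dual operator space structures. -/
structure OperatorLeftIntrovertedSubspace {A : Type*} [NonUnitalNormedRing A] [NormedSpace ℂ A]
    [IsScalarTower ℂ A A] [SMulCommClass ℂ A A] (OA : OperatorSpaceStructure A)
    extends LeftIntrovertedSubspace A where
  OS : OperatorSpaceStructure toNormedSubspace.Space
  cc_incl : IsCompleteContraction OS.norms (dualNorms OA.norms) toNormedSubspace.incl
  cc_act : IsCompleteContraction₂ OS.norms OA.norms OS.norms toLeftHomogeneousSubspace.act
  cc_box : IsCompleteContraction₂ (dualNorms OS.norms) OS.norms OS.norms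
    toLeftIntrovertedSubspace.box

/-- The dual operator space matrix norms on the algebra `S(A^*)^*`. -/
noncomputable def OperatorLeftIntrovertedSubspace.algebraNorms {A : Type*} [NonUnitalNormedRing A]
    [NormedSpace ℂ A] [IsScalarTower ℂ A A] [SMulCommClass ℂ A A] {OA : OperatorSpaceStructure A}
    (S : OperatorLeftIntrovertedSubspace OA) : MatrixNormFamily S.ArensAlgebra :=
  fun n f => dualNorms S.OS.norms n (f.map S.predual)

/-! ### The operator norm of complex matrices -/

section MatrixNorm

open scoped Matrix.Norms.L2Operator ComplexOrder MatrixOrder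
open Matrix

variable {ι κ ι' κ' : Type*} [Fintype ι] [Fintype κ] [Fintype ι'] [Fintype κ']

/-! The predual dictates everything. Since `η(A)` is weak*-dense, an element `ψ` of the predual `P`
is determined by the functional `a ↦ ⟨η(a), ψ⟩`, so `P` embeds into `A^*` and its image can carry
the norm of `P`. Weak*-continuous linear maps have preadjoints. Left multiplication by `η(a)` is
weak*-continuous because `η(a)` lies in the topological centre, and its preadjoint is `φ ↦ φ · a`;
right multiplication by `ν` is weak*-continuous by assumption, and its preadjoint is `φ ↦ ν □ φ`.
Hence the image of `P` is stable under both operations, their norm bounds come from the product of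
`𝔄`, and `⟨μν, ψ⟩ = ⟨μ, ν □ ψ⟩` says that the product of `𝔄` is the Arens product.

For uniqueness, an equivalence `Φ` with the Arens algebra of `T` is the adjoint of an isometric
isomorphism `ρ` of `T` onto `P` (`IsWeakStarContinuous.exists_predual_equiv`). The identity `Φ ∘ η =
η_T` says that `ρ` followed by the embedding of `P` is the inclusion of `T` into `A^*`; so `T` is
the same subspace with the same norm.

The operator version uses the same maps. What it needs in addition is that the matrix norms of a
predual can be recovered from those of the dual, i.e. that `V → V^**` is completely isometric
(`OperatorSpaceStructure.norms_le_of_forall_dual`). A norming functional `F` of a matrix over `V` is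
controlled, by a Hahn–Banach sandwich argument, by two positive functionals on scalar matrices
(`exists_positive_functionals`). Factorising slightly enlarged densities of these turns `F` into a
complete contraction into `M_n` that almost norms the matrix (`exists_norming_matrix`). Every
complete contractivity estimate then reduces to reindexing a matrix of pairings. -/

theorem norm_bilin_le_l2_opNorm [DecidableEq κ] (M : Matrix ι κ ℂ) (x : ι → ℂ) (y : κ → ℂ) :
    ‖∑ s, ∑ t, x s * M s t * y t‖ ≤ ‖M‖ * √(∑ s, ‖x s‖ ^ 2) * √(∑ t, ‖y t‖ ^ 2) := by
  have h := norm_inner_le_norm (𝕜 := ℂ) (WithLp.toLp 2 (star x)) (WithLp.toLp 2 (M *ᵥ y))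
  have h2 := M.l2_opNorm_mulVec (WithLp.toLp 2 y)
  have e : inner ℂ (WithLp.toLp 2 (star x)) (WithLp.toLp 2 (M *ᵥ y))
      = ∑ s, ∑ t, x s * M s t * y t := by
    simp [PiLp.inner_apply, mulVec, dotProduct, Finset.mul_sum, mul_comm, mul_left_comm]
  have hx : ‖WithLp.toLp 2 (star x)‖ = √(∑ s, ‖x s‖ ^ 2) := by
    simp [EuclideanSpace.norm_eq]
  have hy : ‖WithLp.toLp 2 y‖ = √(∑ t, ‖y t‖ ^ 2) := by
    simp [EuclideanSpace.norm_eq]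
  rw [e, hx] at h
  rw [hy] at h2
  refine h.trans ?_
  rw [mul_comm ‖M‖, mul_assoc]
  exact mul_le_mul_of_nonneg_left h2 (Real.sqrt_nonneg _)

/-- The arithmetic mean of the squared norms, instead of their product, is the form that Hahn–Banach
delivers later. Nothing is lost: it suffices to test a unit vector `y` against the normalised
conjugate of `M y`. -/
theorem l2_opNorm_le_of_bilin [DecidableEq κ] (M : Matrix ι κ ℂ) {C : ℝ} (hC : 0 ≤ C)
    (h : ∀ (x : ι → ℂ) (y : κ → ℂ), ‖∑ s, ∑ t, x s * M s t * y t‖ ≤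
      C * ((∑ s, ‖x s‖ ^ 2 + ∑ t, ‖y t‖ ^ 2) / 2)) : ‖M‖ ≤ C := by
  rw [Matrix.l2_opNorm_def]
  refine ContinuousLinearMap.opNorm_le_of_unit_norm hC fun y hy => ?_
  set z : EuclideanSpace ℂ ι := (toEuclideanLin.trans LinearMap.toContinuousLinearMap M) y with hz
  by_cases hz0 : ‖z‖ = 0
  · rw [hz0]; exact hC
  have key := h (fun s => (‖z‖⁻¹ : ℂ) * star (z s)) y
  have e : ∑ s, ∑ t, ((‖z‖⁻¹ : ℂ) * star (z s)) * M s t * y t = ‖z‖ := by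
    have hzs : ∀ s, ∑ t, M s t * y t = z s := fun s => rfl
    simp_rw [mul_assoc, ← Finset.mul_sum, hzs]
    have : ∑ s, star (z s) * z s = (‖z‖ : ℂ) ^ 2 := by
      have h := inner_self_eq_norm_sq_to_K (𝕜 := ℂ) z
      rw [PiLp.inner_apply] at h
      simpa [mul_comm, Complex.mul_conj'] using h
    rw [this, pow_two, ← mul_assoc, inv_mul_cancel₀ (by exact_mod_cast hz0), one_mul]
  have e1 : ∑ s, ‖(‖z‖⁻¹ : ℂ) * star (z s)‖ ^ 2 = 1 := by
    simp only [norm_mul, norm_inv, norm_star, mul_pow, ← Finset.mul_sum, Complex.norm_real,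
      norm_norm]
    rw [← EuclideanSpace.norm_sq_eq]
    field_simp
  have e2 : ∑ t, ‖y t‖ ^ 2 = 1 := by rw [← EuclideanSpace.norm_sq_eq, hy]; norm_num
  rw [e, e1, e2] at key
  simpa using key

/-- Relabelling rows and columns only permutes the coordinates of the test vectors. -/
theorem l2_opNorm_submatrix_le [DecidableEq κ] [DecidableEq κ'] (M : Matrix ι κ ℂ) (e : ι' ≃ ι) (f : κ' ≃ κ) :
    ‖M.submatrix e f‖ ≤ ‖M‖ := by
  refine l2_opNorm_le_of_bilin _ (norm_nonneg _) fun x y => ?_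
  have h := norm_bilin_le_l2_opNorm M (x ∘ e.symm) (y ∘ f.symm)
  have e1 : ∑ s, ∑ t, (x ∘ e.symm) s * M s t * (y ∘ f.symm) t
      = ∑ s, ∑ t, x s * M.submatrix e f s t * y t := by
    rw [← e.sum_comp]
    refine Finset.sum_congr rfl fun s _ => ?_
    rw [← f.sum_comp]
    simp
  have e2 : ∑ s, ‖(x ∘ e.symm) s‖ ^ 2 = ∑ s, ‖x s‖ ^ 2 := by
    rw [← e.sum_comp]; simp
  have e3 : ∑ s, ‖(y ∘ f.symm) s‖ ^ 2 = ∑ s, ‖y s‖ ^ 2 := by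
    rw [← f.sum_comp]; simp
  rw [e1, e2, e3] at h
  refine h.trans ?_
  rw [mul_assoc]
  refine mul_le_mul_of_nonneg_left ?_ (norm_nonneg _)
  have hx : 0 ≤ ∑ s, ‖x s‖ ^ 2 := by positivity
  have hy : 0 ≤ ∑ s, ‖y s‖ ^ 2 := by positivity
  nlinarith [sq_nonneg (√(∑ s, ‖x s‖ ^ 2) - √(∑ s, ‖y s‖ ^ 2)), Real.sq_sqrt hx, Real.sq_sqrt hy]

theorem l2_opNorm_submatrix [DecidableEq κ] [DecidableEq κ'] (M : Matrix ι κ ℂ) (e : ι' ≃ ι) (f : κ' ≃ κ) :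
    ‖M.submatrix e f‖ = ‖M‖ := by
  refine le_antisymm (l2_opNorm_submatrix_le M e f) ?_
  simpa using l2_opNorm_submatrix_le (M.submatrix e f) e.symm f.symm

/-- The right side is the squared Hilbert–Schmidt norm of `S α`; through it, trace functionals
become Euclidean norms of test vectors. -/
theorem trace_mul_mul_conjTranspose (S : Matrix ι ι ℂ) (α : Matrix ι κ ℂ) :
    ((Sᴴ * S) * (α * αᴴ)).trace = ((∑ i, ∑ k, ‖(S * α) i k‖ ^ 2 : ℝ) : ℂ) := by
  have : ((Sᴴ * S) * (α * αᴴ)).trace = ((S * α) * (S * α)ᴴ).trace := by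
    rw [Matrix.mul_assoc, Matrix.trace_mul_comm, conjTranspose_mul]
    simp only [Matrix.mul_assoc]
  rw [this]
  push_cast
  refine Finset.sum_congr rfl fun i _ => ?_
  rw [diag_apply, Matrix.mul_apply]
  refine Finset.sum_congr rfl fun k _ => ?_
  rw [conjTranspose_apply, RCLike.star_def, Complex.mul_conj, Complex.normSq_eq_norm_sq]
  push_cast; rfl

/-- A real functional on the matrices that is nonnegative on positive semidefinite matrices is
represented by a positive semidefinite matrix. -/
theorem exists_posSemidef_trace_eq [DecidableEq ι] (p : Matrix ι ι ℂ →ₗ[ℝ] ℝ)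
    (hp : ∀ X : Matrix ι ι ℂ, X.PosSemidef → 0 ≤ p X) :
    ∃ H : Matrix ι ι ℂ, H.PosSemidef ∧
      ∀ X : Matrix ι ι ℂ, X.IsHermitian → (H * X).trace = (p X : ℂ) := by
  -- The complex-linear functional with real part `p`; trace duality represents it by `Q`. For
  -- Hermitian `X`, taking real parts replaces `Q` by its Hermitian part.
  let pc : Matrix ι ι ℂ →ₗ[ℂ] ℂ := Module.Dual.extendRCLike p
  have hpc : ∀ X, (pc X).re = p X := fun X => by
    simp [pc, Module.Dual.extendRCLike_apply]
  let Q : Matrix ι ι ℂ := Matrix.of fun i k => pc (Matrix.single k i 1)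
  have hQ : ∀ X, (Q * X).trace = pc X := fun X => by
    conv_rhs => rw [Matrix.matrix_eq_sum_single X]
    simp only [map_sum, Matrix.trace, diag_apply, Matrix.mul_apply, Q, Matrix.of_apply]
    rw [Finset.sum_comm]
    refine Finset.sum_congr rfl fun i _ => Finset.sum_congr rfl fun k _ => ?_
    have : Matrix.single i k (X i k) = X i k • Matrix.single i k (1 : ℂ) := by simp
    rw [this, map_smul, smul_eq_mul, mul_comm]
  have hH : ∀ X : Matrix ι ι ℂ, X.IsHermitian →
      (((1 / 2 : ℂ) • (Q + Qᴴ)) * X).trace = (p X : ℂ) := fun X hX => by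
    have h2 : (Qᴴ * X).trace = star (pc X) := by
      rw [← hQ, ← trace_conjTranspose, conjTranspose_mul, hX.eq, trace_mul_comm]
    rw [smul_mul, trace_smul, add_mul, trace_add, hQ, h2, ← hpc, RCLike.star_def,
      Complex.add_conj, smul_eq_mul]
    push_cast; ring
  refine ⟨(1 / 2 : ℂ) • (Q + Qᴴ), .of_dotProduct_mulVec_nonneg ?_ fun x => ?_, hH⟩
  · rw [IsHermitian, conjTranspose_smul, conjTranspose_add, conjTranspose_conjTranspose, add_comm]
    simp
  · have hx : (vecMulVec x (star x)).PosSemidef := posSemidef_vecMulVec_self_star x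
    have := hH _ hx.isHermitian
    rw [mul_vecMulVec, trace_vecMulVec, dotProduct_comm] at this
    rw [this]
    exact_mod_cast hp _ hx

/-- A real functional on the matrices that is nonnegative on positive semidefinite matrices is
dominated by `X ↦ tr (Sᴴ S X)` with an invertible `S`, up to an error in the trace of `Sᴴ S`. -/
theorem exists_isUnit_dominating [DecidableEq ι] (p : Matrix ι ι ℂ →ₗ[ℝ] ℝ)
    (hp : ∀ X : Matrix ι ι ℂ, X.PosSemidef → 0 ≤ p X) {ε : ℝ} (hε : 0 < ε) :
    ∃ S : Matrix ι ι ℂ, IsUnit S ∧ (∑ i, ∑ k, ‖S i k‖ ^ 2 = p 1 + ε * Fintype.card ι) ∧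
      ∀ (r : ℕ) (α : Matrix ι (Fin r) ℂ), p (α * αᴴ) ≤ ∑ i, ∑ k, ‖(S * α) i k‖ ^ 2 := by
  obtain ⟨H, hH, hHp⟩ := exists_posSemidef_trace_eq p hp
  -- The perturbation by `ε` makes the density invertible, at the cost of `ε` times the size in the
  -- trace.
  have hpos : (H + (ε : ℂ) • (1 : Matrix ι ι ℂ)).PosDef :=
    PosDef.posSemidef_add hH (PosDef.one.smul (by exact_mod_cast hε))
  obtain ⟨S, hS⟩ := CStarAlgebra.nonneg_iff_eq_star_mul_self.mp hpos.posSemidef.nonneg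
  rw [star_eq_conjTranspose] at hS
  have htr : ∀ X : Matrix ι ι ℂ, X.IsHermitian →
      ((Sᴴ * S) * X).trace = (p X : ℂ) + ε * X.trace := fun X hX => by
    rw [← hS, add_mul, trace_add, hHp X hX, smul_mul, one_mul, trace_smul, smul_eq_mul]
  refine ⟨S, ?_, ?_, fun r α => ?_⟩
  · have hu := hpos.isUnit
    rw [hS] at hu
    rw [isUnit_iff_isUnit_det] at hu ⊢
    rw [det_mul] at hu
    exact isUnit_of_mul_isUnit_right hu
  · have h1 := trace_mul_mul_conjTranspose S (1 : Matrix ι ι ℂ)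
    rw [conjTranspose_one, mul_one, htr 1 isHermitian_one, trace_one, mul_one] at h1
    exact_mod_cast h1.symm
  · have h1 := trace_mul_mul_conjTranspose S α
    rw [htr _ (isHermitian_mul_conjTranspose_self α)] at h1
    have h2 := trace_mul_mul_conjTranspose 1 α
    rw [conjTranspose_one, mul_one, one_mul] at h2
    rw [h2] at h1
    have h3 : p (α * αᴴ) + ε * ∑ i, ∑ k, ‖((1 : Matrix ι ι ℂ) * α) i k‖ ^ 2
      = ∑ i, ∑ k, ‖(S * α) i k‖ ^ 2 := by exact_mod_cast h1
    rw [← h3]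
    have : 0 ≤ ε * ∑ i, ∑ k, ‖((1 : Matrix ι ι ℂ) * α) i k‖ ^ 2 := by positivity
    linarith

end MatrixNorm

/-- The sandwich form of the Hahn–Banach theorem. -/
theorem exists_linear_between {E : Type*} [AddCommGroup E] [Module ℝ E] (N : E → ℝ)
    (N_hom : ∀ c : ℝ, 0 < c → ∀ x, N (c • x) = c * N x) (N_add : ∀ x y, N (x + y) ≤ N x + N y)
    (D : Set (E × ℝ)) (D_zero : (0, 0) ∈ D) (D_add : ∀ d ∈ D, ∀ d' ∈ D, d + d' ∈ D)
    (D_smul : ∀ c : ℝ, 0 < c → ∀ d ∈ D, c • d ∈ D) (hD : ∀ d ∈ D, d.2 ≤ N d.1) :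
    ∃ g : E →ₗ[ℝ] ℝ, (∀ x, g x ≤ N x) ∧ ∀ d ∈ D, d.2 ≤ g d.1 := by
  have N_zero : N 0 = 0 := by grind [N_hom 2 (by norm_num) 0, smul_zero]
  -- The infimum over `d` is sublinear in `x`, is at most `N x` (take `d = 0`), and at `-d.1` is at
  -- most `-d.2`. A linear functional below it, extended from the zero subspace, therefore satisfies
  -- both conclusions.
  let f : E → D → ℝ := fun x d => N (x + d.1.1) - d.1.2
  have hne : Nonempty D := ⟨⟨_, D_zero⟩⟩
  have hbd : ∀ x, BddBelow (Set.range (f x)) := fun x => by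
    refine ⟨-N (-x), ?_⟩
    rintro _ ⟨d, rfl⟩
    have h1 := N_add (x + d.1.1) (-x)
    rw [add_neg_cancel_comm] at h1
    have h2 := hD d.1 d.2
    simp only [f]
    linarith
  have hle : ∀ x (d : D), ⨅ d, f x d ≤ N (x + d.1.1) - d.1.2 := fun x d => ciInf_le (hbd x) d
  obtain ⟨g, -, hg⟩ := exists_extension_of_le_sublinear (⊥ : E →ₗ.[ℝ] ℝ) (fun x => ⨅ d, f x d)
    (fun c hc x => by
      -- One inequality for all `c` suffices; the other one is the case of `c⁻¹`.
      have key : ∀ c : ℝ, 0 < c → ∀ x, c * ⨅ d, f x d ≤ ⨅ d, f (c • x) d := fun c hc x => by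
        refine le_ciInf fun d => ?_
        have h := hle x ⟨c⁻¹ • d.1, D_smul _ (inv_pos.2 hc) _ d.2⟩
        have h' := mul_le_mul_of_nonneg_left h hc.le
        refine h'.trans_eq ?_
        have e : c • x + d.1.1 = c • (x + c⁻¹ • d.1.1) := by
          rw [smul_add, smul_smul, mul_inv_cancel₀ hc.ne', one_smul]
        simp only [f, e, N_hom c hc, Prod.smul_fst, Prod.smul_snd, smul_eq_mul]
        field_simp
      refine le_antisymm ?_ (key c hc x)
      have := mul_le_mul_of_nonneg_left (key c⁻¹ (inv_pos.2 hc) (c • x)) hc.le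
      rwa [smul_smul, inv_mul_cancel₀ hc.ne', one_smul, mul_inv_cancel_left₀ hc.ne'] at this)
    (fun x y => by
      refine le_ciInf_add_ciInf fun d d' => ?_
      have h := hle (x + y) ⟨_, D_add _ d.2 _ d'.2⟩
      refine h.trans ?_
      have e : x + y + (d.1 + d'.1).1 = (x + d.1.1) + (y + d'.1.1) := by
        rw [Prod.fst_add]; abel
      have := N_add (x + d.1.1) (y + d'.1.1)
      simp only [e, f, Prod.snd_add]
      linarith)
    (fun x => by
      have hx : (x : E) = 0 := by
        exact (Submodule.mem_bot ℝ).1 x.2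
      rw [show x = 0 from Subtype.ext hx, LinearPMap.map_zero]
      refine le_ciInf fun d => ?_
      have := hD d.1 d.2
      simp only [f, ZeroMemClass.coe_zero, zero_add]
      linarith)
  refine ⟨g, fun x => (hg x).trans ?_, fun d hd => ?_⟩
  · simpa using hle x ⟨_, D_zero⟩
  · have h := (hg (-d.1)).trans (hle (-d.1) ⟨d, hd⟩)
    simp only [neg_add_cancel, N_zero, map_neg] at h
    linarith

/-! ### Duality of operator spaces -/

section OperatorSpaceDuality

open scoped Matrix.Norms.L2Operator ComplexOrder MatrixOrder
open Matrix

/-- The matrix `[f_ij(v_kl)]` of scalars, for matrices `f` of functionals and `v` of vectors. -/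
noncomputable abbrev matrixPairing {V : Type*} [NormedAddCommGroup V] [NormedSpace ℂ V] {n m : ℕ}
    (f : Matrix (Fin n) (Fin n) (StrongDual ℂ V)) (v : Matrix (Fin m) (Fin m) V) :
    Matrix (Fin n × Fin m) (Fin n × Fin m) ℂ :=
  Matrix.of fun p q => f p.1 q.1 (v p.2 q.2)

theorem Seminorm.exists_dual_vector {E : Type*} [AddCommGroup E] [Module ℂ E] (p : Seminorm ℂ E)
    (x : E) : ∃ g : Module.Dual ℂ E, g x = p x ∧ ∀ y, ‖g y‖ ≤ p y := by
  by_cases hx : x = 0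
  · exact ⟨0, by simp [hx], fun y => by simp⟩
  obtain ⟨g, hg, hgp⟩ := Module.Dual.exists_extension_of_le_seminorm (Submodule.span ℂ {x})
    ((p x : ℂ) • (LinearEquiv.coord ℂ E x hx : Submodule.span ℂ {x} →ₗ[ℂ] ℂ)) (p := p)
    (fun y => by
      obtain ⟨y, hy⟩ := y
      obtain ⟨c, rfl⟩ := Submodule.mem_span_singleton.1 hy
      have e : (⟨c • x, hy⟩ : Submodule.span ℂ {x}) =
        c • ⟨x, Submodule.mem_span_singleton_self x⟩ := rfl
      rw [LinearMap.smul_apply, e, map_smul]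
      change ‖(p x : ℂ) • c • LinearEquiv.coord ℂ E x hx _‖ ≤ p (c • x)
      rw [LinearEquiv.coord_self, map_smul_eq_mul]
      simp [abs_of_nonneg (apply_nonneg p x), mul_comm])
  refine ⟨g, ?_, hgp⟩
  have := hg ⟨x, Submodule.mem_span_singleton_self x⟩
  rw [this, LinearMap.smul_apply]
  change (p x : ℂ) • LinearEquiv.coord ℂ E x hx _ = _
  rw [LinearEquiv.coord_self]
  simp

theorem scalarTwoSided_one {V : Type*} [AddCommGroup V] [Module ℂ V] {n : ℕ}
    (v : Matrix (Fin n) (Fin n) V) : scalarTwoSided 1 v 1 = v := by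
  ext i j
  simp [scalarTwoSided, Matrix.one_apply]

theorem scalarTwoSided_smul_smul {V : Type*} [AddCommGroup V] [Module ℂ V] {m n : ℕ} (c d : ℂ)
    (α : Matrix (Fin n) (Fin m) ℂ) (v : Matrix (Fin m) (Fin m) V)
    (β : Matrix (Fin m) (Fin n) ℂ) :
    scalarTwoSided (c • α) v (d • β) = (c * d) • scalarTwoSided α v β := by
  ext i j
  simp [scalarTwoSided, Finset.smul_sum, smul_smul, mul_mul_mul_comm]

theorem scalarTwoSided_smul {V : Type*} [AddCommGroup V] [Module ℂ V] {m n : ℕ} (c : ℂ)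
    (α : Matrix (Fin n) (Fin m) ℂ) (v : Matrix (Fin m) (Fin m) V)
    (β : Matrix (Fin m) (Fin n) ℂ) :
    scalarTwoSided α (c • v) β = c • scalarTwoSided α v β := by
  ext i j
  simp [scalarTwoSided, Finset.smul_sum, smul_smul, mul_comm]

theorem scalarTwoSided_zero {V : Type*} [AddCommGroup V] [Module ℂ V] {m n : ℕ}
    (α : Matrix (Fin n) (Fin m) ℂ) (β : Matrix (Fin m) (Fin n) ℂ) :
    scalarTwoSided α (0 : Matrix (Fin m) (Fin m) V) β = 0 := by
  ext i j
  simp [scalarTwoSided]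

/-- A block row and a block column turn a direct sum into a sum. This makes the set to which the
sandwich theorem is applied closed under addition. -/
theorem scalarTwoSided_matrixDirectSum {V : Type*} [AddCommGroup V] [Module ℂ V] {m m' n : ℕ}
    (α : Matrix (Fin n) (Fin m) ℂ) (v : Matrix (Fin m) (Fin m) V) (β : Matrix (Fin m) (Fin n) ℂ)
    (α' : Matrix (Fin n) (Fin m') ℂ) (v' : Matrix (Fin m') (Fin m') V)
    (β' : Matrix (Fin m') (Fin n) ℂ) :
    scalarTwoSided ((fromCols α α').submatrix id finSumFinEquiv.symm) (matrixDirectSum v v')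
      ((fromRows β β').submatrix finSumFinEquiv.symm id) =
    scalarTwoSided α v β + scalarTwoSided α' v' β' := by
  ext i j
  simp [scalarTwoSided, matrixDirectSum, ← finSumFinEquiv.sum_comp, Fintype.sum_sum_type]

theorem map_matrix_eq_sum_single {V : Type*} [AddCommGroup V] [Module ℂ V] {n : ℕ}
    (F : Module.Dual ℂ (Matrix (Fin n) (Fin n) V)) (w : Matrix (Fin n) (Fin n) V) :
    F w = ∑ i, ∑ j, F (Matrix.single i j (w i j)) := by
  conv_lhs => rw [Matrix.matrix_eq_sum_single w]
  simp only [map_sum]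

theorem l2_opNorm_row_le {m : ℕ} (x : Fin m → ℂ) :
    ‖(Matrix.of fun _ k => x k : Matrix (Fin 1) (Fin m) ℂ)‖ ≤ √(∑ k, ‖x k‖ ^ 2) := by
  set M := (Matrix.of fun _ k => x k : Matrix (Fin 1) (Fin m) ℂ)
  -- The C*-identity: `M Mᴴ` is the `1 × 1` matrix with entry `∑ |x_k|²`.
  have h := l2_opNorm_conjTranspose_mul_self Mᴴ
  have e : Mᴴᴴ * Mᴴ = diagonal fun _ : Fin 1 => ((∑ k, ‖x k‖ ^ 2 : ℝ) : ℂ) := by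
    ext i j
    rw [Subsingleton.elim j i, diagonal_apply_eq]
    simp [M, Matrix.mul_apply, Complex.mul_conj']
  rw [e, l2_opNorm_diagonal, l2_opNorm_conjTranspose, pi_norm_const, Complex.norm_real,
    Real.norm_of_nonneg (by positivity)] at h
  rw [h, Real.sqrt_mul_self (norm_nonneg _)]

theorem l2_opNorm_col_le {m : ℕ} (x : Fin m → ℂ) :
    ‖(Matrix.of fun k _ => x k : Matrix (Fin m) (Fin 1) ℂ)‖ ≤ √(∑ k, ‖x k‖ ^ 2) := by
  have h := l2_opNorm_row_le (star x)
  rw [← l2_opNorm_conjTranspose] at h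
  have e : (Matrix.of fun _ k => star x k : Matrix (Fin 1) (Fin m) ℂ)ᴴ =
      Matrix.of fun k _ => x k := by
    ext; simp
  rw [e] at h
  simpa using h

variable {V : Type*} [NormedAddCommGroup V] [NormedSpace ℂ V]

theorem OperatorSpaceStructure.norm_sum_smul_le (O : OperatorSpaceStructure V) {m : ℕ}
    (v : Matrix (Fin m) (Fin m) V) (x y : Fin m → ℂ) :
    ‖∑ k, ∑ l, (x k * y l) • v k l‖ ≤
      √(∑ k, ‖x k‖ ^ 2) * O.mnorm m v * √(∑ k, ‖y k‖ ^ 2) := by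
  rw [← O.norm_one]
  refine (O.two_sided_le m 1 (Matrix.of fun _ k => x k) v (Matrix.of fun k _ => y k)).trans ?_
  gcongr
  · exact l2_opNorm_row_le x
  · exact l2_opNorm_col_le y

/-- A crude bound, showing that every finite matrix of functionals is completely bounded. Thus the
infimum in `dualNorms` runs over a nonempty set and is not the default value `0`. -/
theorem OperatorSpaceStructure.norm_matrixPairing_le_sum (O : OperatorSpaceStructure V) {n m : ℕ}
    (f : Matrix (Fin n) (Fin n) (StrongDual ℂ V)) (v : Matrix (Fin m) (Fin m) V) :
    ‖matrixPairing f v‖ ≤ (∑ i, ∑ j, ‖f i j‖) * O.mnorm m v := by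
  have hv : 0 ≤ O.mnorm m v := apply_nonneg _ _
  refine l2_opNorm_le_of_bilin _ (by positivity) fun x y => ?_
  have e : ∑ s, ∑ t, x s * matrixPairing f v s t * y t =
      ∑ i, ∑ j, f i j (∑ k, ∑ l, (x (i, k) * y (j, l)) • v k l) := by
    simp only [Fintype.sum_prod_type, map_sum, map_smul, matrixPairing, Matrix.of_apply,
      smul_eq_mul]
    refine Finset.sum_congr rfl fun i _ => ?_
    rw [Finset.sum_comm]
    refine Finset.sum_congr rfl fun j _ => Finset.sum_congr rfl fun k _ =>
      Finset.sum_congr rfl fun l _ => ?_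
    ring
  rw [e]
  have hx : ∀ i, ∑ k, ‖x (i, k)‖ ^ 2 ≤ ∑ s, ‖x s‖ ^ 2 := fun i => by
    rw [Fintype.sum_prod_type]
    exact Finset.single_le_sum (f := fun i => ∑ k, ‖x (i, k)‖ ^ 2)
      (fun _ _ => by positivity) (Finset.mem_univ i)
  have hy : ∀ i, ∑ k, ‖y (i, k)‖ ^ 2 ≤ ∑ s, ‖y s‖ ^ 2 := fun i => by
    rw [Fintype.sum_prod_type]
    exact Finset.single_le_sum (f := fun i => ∑ k, ‖y (i, k)‖ ^ 2)
      (fun _ _ => by positivity) (Finset.mem_univ i)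
  rw [Finset.sum_mul, Finset.sum_mul]
  refine (norm_sum_le _ _).trans (Finset.sum_le_sum fun i _ => ?_)
  rw [Finset.sum_mul, Finset.sum_mul]
  refine (norm_sum_le _ _).trans (Finset.sum_le_sum fun j _ => ?_)
  refine ((f i j).le_opNorm _).trans ?_
  rw [mul_assoc]
  refine mul_le_mul_of_nonneg_left ?_ (norm_nonneg _)
  refine (O.norm_sum_smul_le v _ _).trans ?_
  rw [mul_comm (√_), mul_assoc]
  refine mul_le_mul_of_nonneg_left ?_ hv
  have hx0 : 0 ≤ ∑ k, ‖x (i, k)‖ ^ 2 := by positivity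
  have hy0 : 0 ≤ ∑ k, ‖y (j, k)‖ ^ 2 := by positivity
  nlinarith [sq_nonneg (√(∑ k, ‖x (i, k)‖ ^ 2) - √(∑ k, ‖y (j, k)‖ ^ 2)), Real.sq_sqrt hx0,
    Real.sq_sqrt hy0, hx i, hy j]

theorem dualNorms_le (N : MatrixNormFamily V) {n : ℕ}
    (f : Matrix (Fin n) (Fin n) (StrongDual ℂ V)) {C : ℝ} (hC : 0 ≤ C)
    (h : ∀ (m : ℕ) (v : Matrix (Fin m) (Fin m) V), ‖matrixPairing f v‖ ≤ C * N m v) :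
    dualNorms N n f ≤ C :=
  csInf_le ⟨0, fun _ h => h.1⟩ ⟨hC, h⟩

theorem OperatorSpaceStructure.norm_matrixPairing_le (O : OperatorSpaceStructure V) {n m : ℕ}
    (f : Matrix (Fin n) (Fin n) (StrongDual ℂ V)) (v : Matrix (Fin m) (Fin m) V) :
    ‖matrixPairing f v‖ ≤ dualNorms O.norms n f * O.norms m v := by
  have hv : 0 ≤ O.norms m v := apply_nonneg (O.mnorm m) v
  have hne : ∃ C, 0 ≤ C ∧ ∀ (m : ℕ) (v : Matrix (Fin m) (Fin m) V),
      ‖matrixPairing f v‖ ≤ C * O.norms m v :=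
    ⟨∑ i, ∑ j, ‖f i j‖, by positivity, fun m v => O.norm_matrixPairing_le_sum f v⟩
  -- One cannot divide by a vanishing norm, but then any admissible constant forces the pairing to
  -- vanish.
  rcases hv.eq_or_lt with h0 | hpos
  · obtain ⟨C, -, hC⟩ := hne
    have := hC m v
    rw [← h0] at this ⊢
    simpa using this
  · rw [← div_le_iff₀ hpos]
    refine le_csInf hne fun C hC => ?_
    rw [div_le_iff₀ hpos]
    exact hC.2 m v

/-- For a contractive functional `F` on `M_n(V)` there are positive functionals `p` and `q` on
the matrices, of norm at most one, with `|F(α v β)| ≤ ‖v‖ (p(α αᴴ) + q(βᴴ β)) / 2`. -/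
theorem OperatorSpaceStructure.exists_positive_functionals (O : OperatorSpaceStructure V) {n : ℕ}
    (F : Module.Dual ℂ (Matrix (Fin n) (Fin n) V)) (hF : ∀ w, ‖F w‖ ≤ O.mnorm n w) :
    ∃ p q : Matrix (Fin n) (Fin n) ℂ →ₗ[ℝ] ℝ,
      (∀ X, X.PosSemidef → 0 ≤ p X) ∧ (∀ X, X.PosSemidef → 0 ≤ q X) ∧ p 1 ≤ 1 ∧ q 1 ≤ 1 ∧
      ∀ (r : ℕ) (α : Matrix (Fin n) (Fin r) ℂ) (v : Matrix (Fin r) (Fin r) V)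
        (β : Matrix (Fin r) (Fin n) ℂ),
        ‖F (scalarTwoSided α v β)‖ ≤ O.mnorm r v * ((p (α * αᴴ) + q (βᴴ * β)) / 2) := by
  suffices H : ∃ p q : Matrix (Fin n) (Fin n) ℂ →ₗ[ℝ] ℝ,
      (∀ X, X.PosSemidef → 0 ≤ p X) ∧ (∀ X, X.PosSemidef → 0 ≤ q X) ∧ p 1 ≤ 1 ∧ q 1 ≤ 1 ∧
      ∀ (r : ℕ) (α : Matrix (Fin n) (Fin r) ℂ) (v : Matrix (Fin r) (Fin r) V)
        (β : Matrix (Fin r) (Fin n) ℂ), O.mnorm r v ≤ 1 →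
        (F (scalarTwoSided α v β)).re ≤ (p (α * αᴴ) + q (βᴴ * β)) / 2 by
    obtain ⟨p, q, hp, hq, hp1, hq1, H⟩ := H
    refine ⟨p, q, hp, hq, hp1, hq1, fun r α v β => ?_⟩
    set w := F (scalarTwoSided α v β) with hw
    rcases (apply_nonneg (O.mnorm r) v).eq_or_lt with h0 | hpos
    · refine ((hF _).trans (O.two_sided_le r n α v β)).trans ?_
      simp [← h0]
    by_cases hw0 : ‖w‖ = 0
    · rw [hw0]
      have h1 := hp _ (posSemidef_self_mul_conjTranspose α)
      have h2 := hq _ (posSemidef_conjTranspose_mul_self β)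
      positivity
    -- This scalar rotates the value of `F` onto the positive axis and normalises `v`, so that the
    -- value becomes `‖w‖ / ‖v‖`.
    have h := H r α ((star w / (‖w‖ * O.mnorm r v : ℝ)) • v) β (by
      rw [map_smul_eq_mul, norm_div, norm_star, Complex.norm_real,
        Real.norm_of_nonneg (by positivity)]
      field_simp
      rfl)
    rw [scalarTwoSided_smul, map_smul, ← hw, smul_eq_mul, div_mul_eq_mul_div, RCLike.star_def,
      Complex.conj_mul', ← Complex.ofReal_pow, ← Complex.ofReal_div, Complex.ofReal_re,
      pow_two, mul_div_mul_left _ _ hw0, div_le_iff₀ hpos, mul_comm] at h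
    exact h
  -- A convex cone: sums come from direct sums, positive multiples from scaling both `α` and `β` by
  -- `√c`. The sublinear bound holds since `Re F(α v β) ≤ ‖α‖ ‖β‖ ≤ (‖α‖² + ‖β‖²) / 2` and by the
  -- C*-identity.
  let D : Set ((Matrix (Fin n) (Fin n) ℂ × Matrix (Fin n) (Fin n) ℂ) × ℝ) :=
    {d | ∃ (r : ℕ) (α : Matrix (Fin n) (Fin r) ℂ) (v : Matrix (Fin r) (Fin r) V)
      (β : Matrix (Fin r) (Fin n) ℂ), O.mnorm r v ≤ 1 ∧
      d = ((α * αᴴ, βᴴ * β), (F (scalarTwoSided α v β)).re)}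
  obtain ⟨g, hgN, hgD⟩ := exists_linear_between
    (fun X : Matrix (Fin n) (Fin n) ℂ × Matrix (Fin n) (Fin n) ℂ => (‖X.1‖ + ‖X.2‖) / 2)
    (fun c hc X => by
      have (Y : Matrix (Fin n) (Fin n) ℂ) : ‖c • Y‖ = c * ‖Y‖ := by
        rw [show c • Y = (c : ℂ) • Y by ext; simp, norm_smul, Complex.norm_real,
          Real.norm_of_nonneg hc.le]
      simp only [Prod.smul_fst, Prod.smul_snd, this]
      ring)
    (fun X Y => by
      have h1 := norm_add_le X.1 Y.1
      have h2 := norm_add_le X.2 Y.2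
      simp only [Prod.fst_add, Prod.snd_add]
      linarith)
    D ⟨0, 0, 0, 0, by simp, by simp [scalarTwoSided_zero]; rfl⟩
    (by
      rintro _ ⟨r, α, v, β, hv, rfl⟩ _ ⟨r', α', v', β', hv', rfl⟩
      refine ⟨r + r', (fromCols α α').submatrix id finSumFinEquiv.symm, matrixDirectSum v v',
        (fromRows β β').submatrix finSumFinEquiv.symm id, ?_, ?_⟩
      · rw [O.direct_sum]
        exact max_le hv hv'
      · rw [scalarTwoSided_matrixDirectSum, conjTranspose_submatrix, conjTranspose_submatrix,
          submatrix_mul_equiv, submatrix_mul_equiv, conjTranspose_fromCols_eq_fromRows_conjTranspose,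
          conjTranspose_fromRows_eq_fromCols_conjTranspose, fromCols_mul_fromRows,
          fromCols_mul_fromRows]
        simp)
    (by
      rintro c hc _ ⟨r, α, v, β, hv, rfl⟩
      have hcc : ((√c : ℝ) : ℂ) * (√c : ℝ) = c := by
        rw [← Complex.ofReal_mul, Real.mul_self_sqrt hc.le]
      refine ⟨r, ((√c : ℝ) : ℂ) • α, v, ((√c : ℝ) : ℂ) • β, hv, ?_⟩
      have hsm (Y : Matrix (Fin n) (Fin n) ℂ) : c • Y = (c : ℂ) • Y := by ext; simp
      rw [scalarTwoSided_smul_smul, hcc]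
      simp only [conjTranspose_smul, smul_mul, Matrix.mul_smul, smul_smul, RCLike.star_def,
        Complex.conj_ofReal, hcc, map_smul, Prod.smul_mk, smul_eq_mul, Complex.re_ofReal_mul, hsm])
    (by
      rintro _ ⟨r, α, v, β, hv, rfl⟩
      have h1 : ‖α * αᴴ‖ = ‖α‖ * ‖α‖ := by
        simpa [l2_opNorm_conjTranspose] using l2_opNorm_conjTranspose_mul_self αᴴ
      have h2 := l2_opNorm_conjTranspose_mul_self β
      have h3 := (Complex.re_le_norm _).trans ((hF _).trans (O.two_sided_le r n α v β))
      have h4 : ‖α‖ * O.mnorm r v * ‖β‖ ≤ ‖α‖ * 1 * ‖β‖ := by gcongr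
      dsimp only
      rw [h1, h2]
      nlinarith [sq_nonneg (‖α‖ - ‖β‖)])
  have hone : ‖(1 : Matrix (Fin n) (Fin n) ℂ)‖ ≤ 1 := by
    have h := l2_opNorm_conjTranspose_mul_self (1 : Matrix (Fin n) (Fin n) ℂ)
    rw [conjTranspose_one, mul_one] at h
    nlinarith [norm_nonneg (1 : Matrix (Fin n) (Fin n) ℂ)]
  -- The factor `2` undoes the halves. Positivity comes from the elements of `D` with `v = 0`, and
  -- the bounds at `1` from `‖1‖ ≤ 1`, which also holds for `n = 0`.
  refine ⟨(2 : ℝ) • g ∘ₗ LinearMap.inl ℝ _ _, (2 : ℝ) • g ∘ₗ LinearMap.inr ℝ _ _, fun X hX => ?_,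
    fun X hX => ?_, ?_, ?_, fun r α v β hv => ?_⟩
  · obtain ⟨B, rfl⟩ := CStarAlgebra.nonneg_iff_eq_star_mul_self.mp hX.nonneg
    have := hgD _ ⟨n, Bᴴ, 0, 0, by simp, rfl⟩
    simpa [scalarTwoSided_zero, star_eq_conjTranspose] using this
  · obtain ⟨B, rfl⟩ := CStarAlgebra.nonneg_iff_eq_star_mul_self.mp hX.nonneg
    have := hgD _ ⟨n, 0, 0, B, by simp, rfl⟩
    simpa [scalarTwoSided_zero, star_eq_conjTranspose] using this
  · have := hgN (1, 0)
    simp only [norm_zero] at this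
    simp only [LinearMap.smul_apply, LinearMap.comp_apply, LinearMap.inl_apply, smul_eq_mul]
    linarith
  · have := hgN (0, 1)
    simp only [norm_zero] at this
    simp only [LinearMap.smul_apply, LinearMap.comp_apply, LinearMap.inr_apply, smul_eq_mul]
    linarith
  · have := hgD _ ⟨r, α, v, β, hv, rfl⟩
    refine this.trans_eq ?_
    simp only [LinearMap.smul_apply, LinearMap.comp_apply, LinearMap.inl_apply,
      LinearMap.inr_apply, smul_eq_mul]
    rw [← mul_add, mul_div_cancel_left₀ _ two_ne_zero, ← map_add]
    simp

/-- The matrix norms of an operator space are determined by the complete contractions into matrix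
algebras. -/
theorem OperatorSpaceStructure.exists_norming_matrix (O : OperatorSpaceStructure V) {n : ℕ}
    (v₀ : Matrix (Fin n) (Fin n) V) {ε : ℝ} (hε : 0 < ε) :
    ∃ f : Matrix (Fin n) (Fin n) (StrongDual ℂ V),
      (∀ (m : ℕ) (v : Matrix (Fin m) (Fin m) V), ‖matrixPairing f v‖ ≤ O.mnorm m v) ∧
      O.mnorm n v₀ ≤ ‖matrixPairing f v₀‖ * (1 + ε) := by
  obtain ⟨F, hF₀, hF⟩ := (O.mnorm n).exists_dual_vector v₀
  obtain ⟨p, q, hp, hq, hp1, hq1, hpq⟩ := O.exists_positive_functionals F hF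
  -- The total trace error is `n ε / (n + 1) ≤ ε`; the denominator is also safe for `n = 0`.
  have hε' : 0 < ε / (n + 1) := by positivity
  obtain ⟨S, hS, hS1, hSp⟩ := exists_isUnit_dominating p hp hε'
  obtain ⟨R, hR, hR1, hRq⟩ := exists_isUnit_dominating q hq hε'
  have hSdet := (isUnit_iff_isUnit_det S).1 hS
  have hRdet := (isUnit_iff_isUnit_det R).1 hR
  have hnε : ε / (n + 1) * (Fintype.card (Fin n) : ℝ) ≤ ε := by
    rw [Fintype.card_fin, div_mul_eq_mul_div, div_le_iff₀ (by positivity)]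
    nlinarith
  -- The entries of `F` are continuous, by the two-sided axiom applied to a unit column and a unit
  -- row.
  let Fe : Fin n → Fin n → StrongDual ℂ V := fun i k =>
    LinearMap.mkContinuous (F ∘ₗ Matrix.singleLinearMap ℂ i k)
      (‖(Matrix.single i 0 1 : Matrix (Fin n) (Fin 1) ℂ)‖ *
        ‖(Matrix.single 0 k 1 : Matrix (Fin 1) (Fin n) ℂ)‖) fun v => by
      have h := O.two_sided_le 1 n (Matrix.single i 0 1) (Matrix.of fun _ _ => v)
        (Matrix.single 0 k 1)
      have e : scalarTwoSided (Matrix.single i 0 1 : Matrix (Fin n) (Fin 1) ℂ)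
          (Matrix.of fun _ _ => v) (Matrix.single 0 k 1) = Matrix.single i k v := by
        ext a b
        simp only [scalarTwoSided, Matrix.single_apply, Matrix.of_apply, Finset.univ_unique,
          Finset.sum_singleton]
        by_cases ha : i = a <;> by_cases hb : k = b <;> simp [ha, hb]
      rw [e, O.norm_one] at h
      refine ((hF _).trans h).trans_eq (by ring)
  have hFe : ∀ i k v, Fe i k v = F (Matrix.single i k v) := fun _ _ _ => rfl
  -- Chosen so that, with `x` and `y` reshaped into `n × m` matrices `X` and `Y`, the bilinear form
  -- of the pairing matrix is `F(S⁻¹ X v Yᵀ (R⁻¹)ᴴ)`.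
  let f : Matrix (Fin n) (Fin n) (StrongDual ℂ V) := Matrix.of fun i k =>
    ∑ a, ∑ b, (S⁻¹ a i * star (R⁻¹ b k)) • Fe a b
  have key : ∀ (m : ℕ) (v : Matrix (Fin m) (Fin m) V) (x y : Fin n × Fin m → ℂ),
      ∑ s, ∑ t, x s * matrixPairing f v s t * y t =
        F (scalarTwoSided (S⁻¹ * Matrix.of fun i k => x (i, k)) v
          ((Matrix.of fun l k => y (k, l)) * (R⁻¹)ᴴ)) := by
    intro m v x y
    rw [map_matrix_eq_sum_single]
    simp only [← hFe, scalarTwoSided, Matrix.of_apply, map_sum, map_smul, f, matrixPairing,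
      Fintype.sum_prod_type, _root_.sum_apply, _root_.smul_apply, Matrix.mul_apply,
      smul_eq_mul, Finset.mul_sum, Finset.sum_mul, conjTranspose_apply]
    simp only [← Fintype.sum_prod_type']
    refine Fintype.sum_equiv
      { toFun := fun ⟨i, k, j, l, a, b⟩ => (a, b, k, l, j, i)
        invFun := fun ⟨a, b, k, l, j, i⟩ => (i, k, j, l, a, b)
        left_inv := fun _ => rfl
        right_inv := fun _ => rfl } _ _ fun ⟨i, k, j, l, a, b⟩ => ?_
    simp only [Equiv.coe_fn_mk]
    ring
  refine ⟨f, fun m v => ?_, ?_⟩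
  -- With `α = S⁻¹ X`, domination bounds `p(α αᴴ)` by the squared Hilbert–Schmidt norm of `S α = X`,
  -- which is that of `x`; similarly for `q` and `y`.
  · refine l2_opNorm_le_of_bilin _ (apply_nonneg _ _) fun x y => ?_
    rw [key]
    refine (hpq _ _ _ _).trans (mul_le_mul_of_nonneg_left ?_ (apply_nonneg _ _))
    have h1 := hSp m (S⁻¹ * Matrix.of fun i k => x (i, k))
    have h2 := hRq m ((Matrix.of fun l k => y (k, l)) * (R⁻¹)ᴴ)ᴴ
    rw [mul_nonsing_inv_cancel_left _ _ hSdet] at h1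
    rw [conjTranspose_mul, conjTranspose_conjTranspose, mul_nonsing_inv_cancel_left _ _ hRdet,
      ← conjTranspose_conjTranspose (R⁻¹), ← conjTranspose_mul, conjTranspose_conjTranspose] at h2
    simp only [Matrix.of_apply, conjTranspose_apply, norm_star] at h1 h2
    rw [Fintype.sum_prod_type, Fintype.sum_prod_type]
    linarith
  -- Testing at `S` and the conjugate of `R` cancels both inverses and leaves `F v₀`.
  · have h := norm_bilin_le_l2_opNorm (matrixPairing f v₀) (fun s => S s.1 s.2)
      (fun s => star (R s.1 s.2))
    have e1 : (Matrix.of fun i k => S i k) = S := rfl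
    have e2 : (Matrix.of fun l k => star (R k l)) = Rᴴ := rfl
    rw [key, e1, e2, nonsing_inv_mul _ hSdet, ← conjTranspose_mul, nonsing_inv_mul _ hRdet,
      conjTranspose_one, scalarTwoSided_one, hF₀, Complex.norm_real,
      Real.norm_of_nonneg (apply_nonneg _ _), mul_assoc] at h
    refine h.trans (mul_le_mul_of_nonneg_left ?_ (norm_nonneg _))
    simp only [norm_star]
    rw [Fintype.sum_prod_type, Fintype.sum_prod_type, hS1, hR1]
    have hle : ∀ t : ℝ, t ≤ 1 →
        √(t + ε / (n + 1) * (Fintype.card (Fin n) : ℝ)) ≤ √(1 + ε) := fun t ht =>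
      Real.sqrt_le_sqrt (by linarith)
    calc _ ≤ √(1 + ε) * √(1 + ε) :=
          mul_le_mul (hle _ hp1) (hle _ hq1) (Real.sqrt_nonneg _) (Real.sqrt_nonneg _)
      _ = 1 + ε := Real.mul_self_sqrt (by positivity)

/-- The canonical embedding of an operator space into its bidual is completely isometric. -/
theorem OperatorSpaceStructure.norms_le_of_forall_dual (O : OperatorSpaceStructure V) {n : ℕ}
    (v : Matrix (Fin n) (Fin n) V) {C : ℝ} (hC : 0 ≤ C)
    (h : ∀ (m : ℕ) (f : Matrix (Fin m) (Fin m) (StrongDual ℂ V)),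
      ‖matrixPairing f v‖ ≤ dualNorms O.norms m f * C) : O.norms n v ≤ C := by
  have h' : ∀ ε : ℝ, 0 < ε → O.norms n v ≤ C * (1 + ε) := fun ε hε => by
    obtain ⟨f, hf, hfv⟩ := O.exists_norming_matrix v hε
    refine hfv.trans (mul_le_mul_of_nonneg_right ((h n f).trans ?_) (by positivity))
    refine mul_le_of_le_one_left hC (dualNorms_le _ _ zero_le_one fun m v => ?_)
    rw [one_mul]
    exact hf m v
  refine le_of_forall_pos_le_add fun δ hδ => (h' (δ / (C + 1)) (by positivity)).trans ?_
  have : C * (δ / (C + 1)) ≤ δ := by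
    rw [mul_div_assoc', div_le_iff₀ (by positivity)]
    nlinarith
  linarith


end OperatorSpaceDuality

/-! ### Weak* topologies and preadjoints -/

section WeakStar

variable {E P F Q : Type*} [NormedAddCommGroup E] [NormedSpace ℂ E]
  [NormedAddCommGroup P] [NormedSpace ℂ P] [NormedAddCommGroup F] [NormedSpace ℂ F]
  [NormedAddCommGroup Q] [NormedSpace ℂ Q]

theorem continuous_weakStar_eval (j : E ≃ₗᵢ[ℂ] StrongDual ℂ P) (ψ : P) :
    @Continuous E ℂ (weakStarTopology j) _ fun x => j x ψ := by
  let := weakStarTopology j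
  have h : Continuous fun x => StrongDual.toWeakDual (j x) := continuous_induced_dom
  exact (WeakDual.eval_continuous ψ).comp h

/-- Weak*-continuous functionals come from the predual. -/
theorem exists_eq_eval_of_continuous (j : E ≃ₗᵢ[ℂ] StrongDual ℂ P) (g : E →ₗ[ℂ] ℂ)
    (hg : @Continuous E ℂ (weakStarTopology j) _ g) : ∃ ψ : P, ∀ x, j x ψ = g x := by
  let B : E →ₗ[ℂ] P →ₗ[ℂ] ℂ :=
    ContinuousLinearMap.coeLM ℂ ∘ₗ (j.toLinearEquiv : E →ₗ[ℂ] StrongDual ℂ P)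
  -- The weak* topology is the weak topology of the pairing of `E` with `P`, whose continuous
  -- functionals are the evaluations at elements of `P`.
  have htop : weakStarTopology j = (inferInstance : TopologicalSpace (WeakBilin B)) :=
    induced_compose
  rw [htop] at hg
  obtain ⟨ψ, hψ⟩ := LinearMap.dualEmbedding_surjective B
    ({ toLinearMap := g, cont := hg } : StrongDual ℂ (WeakBilin B))
  exact ⟨ψ, fun x => congrArg (fun f : StrongDual ℂ (WeakBilin B) => f x) hψ⟩

theorem IsWeakStarContinuous.exists_preadjoint {j : E ≃ₗᵢ[ℂ] StrongDual ℂ P}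
    {k : F ≃ₗᵢ[ℂ] StrongDual ℂ Q} {f : E →ₗ[ℂ] F} (hf : IsWeakStarContinuous j k f) (φ : Q) :
    ∃ ψ : P, ∀ x, j x ψ = k (f x) φ := by
  refine exists_eq_eval_of_continuous j
    ((ContinuousLinearMap.apply ℂ ℂ φ).toLinearMap ∘ₗ
      (k.toLinearEquiv : F →ₗ[ℂ] StrongDual ℂ Q) ∘ₗ f) ?_
  let := weakStarTopology j
  let := weakStarTopology k
  exact (continuous_weakStar_eval k φ).comp hf

theorem isWeakStarContinuous_of_preadjoint {j : E ≃ₗᵢ[ℂ] StrongDual ℂ P}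
    {k : F ≃ₗᵢ[ℂ] StrongDual ℂ Q} {f : E → F} (ρ : Q → P)
    (h : ∀ x φ, k (f x) φ = j x (ρ φ)) : IsWeakStarContinuous j k f := by
  let := weakStarTopology j
  refine continuous_induced_rng.2 (WeakDual.continuous_of_continuous_eval fun φ => ?_)
  exact (continuous_weakStar_eval j (ρ φ)).congr fun x => (h x φ).symm

theorem norm_le_of_forall_predual (j : E ≃ₗᵢ[ℂ] StrongDual ℂ P) (ψ : P) {C : ℝ} (hC : 0 ≤ C)
    (h : ∀ x, ‖j x ψ‖ ≤ C * ‖x‖) : ‖ψ‖ ≤ C := by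
  refine NormedSpace.norm_le_dual_bound ℂ ψ hC fun f => ?_
  simpa using h (j.symm f)

theorem norm_predual_apply_le (j : E ≃ₗᵢ[ℂ] StrongDual ℂ P) (x : E) (ψ : P) :
    ‖j x ψ‖ ≤ ‖x‖ * ‖ψ‖ := by
  simpa using (j x).le_opNorm ψ

theorem eq_of_forall_predual (j : E ≃ₗᵢ[ℂ] StrongDual ℂ P) {ψ ψ' : P}
    (h : ∀ x, j x ψ = j x ψ') : ψ = ψ' := by
  rw [← sub_eq_zero, ← norm_le_zero_iff]
  exact norm_le_of_forall_predual j _ le_rfl fun x => by simp [h x]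

theorem Submodule.eq_top_of_forall_dual (K : Submodule ℂ P) (hK : IsClosed (K : Set P))
    (h : ∀ f : StrongDual ℂ P, (∀ x ∈ K, f x = 0) → f = 0) : K = ⊤ := by
  refine Submodule.eq_top_iff'.2 fun x => ?_
  -- Closedness serves as the instance that makes the quotient by `K` a normed space, to which
  -- Hahn–Banach is applied.
  have := hK
  have hx := norm_le_zero_iff.1 (NormedSpace.norm_le_dual_bound ℂ (K.mkQ x) le_rfl fun f => by
    have := h (f.comp K.mkQL) fun y hy => by
      have e : K.mkQL y = 0 := (Submodule.Quotient.mk_eq_zero K).2 hy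
      simp [e]
    have e : f (K.mkQ x) = (f.comp K.mkQL) x := rfl
    rw [e, this]
    simp)
  exact (Submodule.Quotient.mk_eq_zero K).1 hx

/-- A weak*-continuous isometric isomorphism is the adjoint of an isometric isomorphism of the
preduals. -/
theorem IsWeakStarContinuous.exists_predual_equiv [CompleteSpace Q]
    {j : E ≃ₗᵢ[ℂ] StrongDual ℂ P} {k : F ≃ₗᵢ[ℂ] StrongDual ℂ Q} {Φ : E ≃ₗᵢ[ℂ] F}
    (hΦ : IsWeakStarContinuous j k Φ) :
    ∃ ρ : Q ≃ₗᵢ[ℂ] P, ∀ x φ, j x (ρ φ) = k (Φ x) φ := by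
  choose ρ hρ using IsWeakStarContinuous.exists_preadjoint
    (f := (Φ.toLinearEquiv : E →ₗ[ℂ] F)) hΦ
  have hρ' : ∀ x φ, j x (ρ φ) = k (Φ x) φ := fun x φ => hρ φ x
  let ρl : Q →ₗᵢ[ℂ] P :=
    { toFun := ρ
      map_add' := fun φ φ' => eq_of_forall_predual j fun x => by simp [hρ']
      map_smul' := fun c φ => eq_of_forall_predual j fun x => by simp [hρ']
      norm_map' := fun φ => by
        refine le_antisymm (norm_le_of_forall_predual j _ (norm_nonneg _) fun x => ?_)
          (norm_le_of_forall_predual k _ (norm_nonneg _) fun y => ?_)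
        · change ‖j x (ρ φ)‖ ≤ _
          rw [hρ', mul_comm]
          simpa using norm_predual_apply_le k (Φ x) φ
        · change _ ≤ ‖ρ φ‖ * _
          have := norm_predual_apply_le j (Φ.symm y) (ρ φ)
          rw [hρ', mul_comm] at this
          simpa using this }
  -- The range is closed because `Q` is complete. A functional on `P` vanishing on it is an element
  -- of `E` that `Φ` sends to zero, hence is zero.
  have hsurj : Function.Surjective ρl := by
    rw [← LinearIsometry.coe_toLinearMap, ← LinearMap.range_eq_top]
    refine Submodule.eq_top_of_forall_dual _ ?_ fun f hf => ?_
    · exact ρl.isometry.isClosedEmbedding.isClosed_range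
    · have h0 : k (Φ (j.symm f)) = 0 := by
        ext φ
        rw [← hρ']
        simpa using hf (ρ φ) ⟨φ, rfl⟩
      simpa using h0
  exact ⟨LinearIsometryEquiv.ofSurjective ρl hsurj, hρ'⟩

/-- The adjoint of an isometric isomorphism, from the dual of the domain to that of the range. -/
noncomputable def dualCongr (e : P ≃ₗᵢ[ℂ] Q) : StrongDual ℂ P ≃ₗᵢ[ℂ] StrongDual ℂ Q where
  toLinearEquiv := (e.toContinuousLinearEquiv.arrowCongr (.refl ℂ ℂ)).toLinearEquiv
  norm_map' f := by
    change ‖f.comp (e.symm.toContinuousLinearEquiv : Q →L[ℂ] P)‖ = ‖f‖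
    refine le_antisymm (ContinuousLinearMap.opNorm_le_bound _ (norm_nonneg _) fun x => ?_)
      (ContinuousLinearMap.opNorm_le_bound _ (norm_nonneg _) fun x => ?_)
    · simpa using f.le_opNorm (e.symm x)
    · simpa using (f.comp (e.symm.toContinuousLinearEquiv : Q →L[ℂ] P)).le_opNorm (e x)

theorem dualCongr_apply (e : P ≃ₗᵢ[ℂ] Q) (f : StrongDual ℂ P) (φ : Q) :
    dualCongr e f φ = f (e.symm φ) := rfl

end WeakStar

/-! ### The introverted subspace of a homogeneous left dual Banach algebra -/

section Construction

variable {A 𝔄 P : Type*} [NonUnitalNormedRing A] [NormedSpace ℂ A]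
  [NonUnitalNormedRing 𝔄] [NormedSpace ℂ 𝔄] [NormedAddCommGroup P] [NormedSpace ℂ P]
  {j : 𝔄 ≃ₗᵢ[ℂ] StrongDual ℂ P} {η : A →L[ℂ] 𝔄}

@[simp] theorem predualPullback_apply (ψ : P) (a : A) :
    predualPullback j η ψ a = j (η a) ψ := rfl

namespace IsHLDBA

/-- Evaluation at `ψ` is weak*-continuous, so it vanishes once it vanishes on the weak*-dense range
of `η`. -/
theorem predualPullback_injective (h : IsHLDBA j η) :
    Function.Injective (predualPullback j η) := by
  refine (injective_iff_map_eq_zero _).2 fun ψ hψ => eq_of_forall_predual j fun x => ?_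
  let := weakStarTopology j
  have := h.dense_range.equalizer (continuous_weakStar_eval j ψ)
    (continuous_weakStar_eval j 0) (funext fun a => by
      have := congrArg (fun f : StrongDual ℂ A => f a) hψ
      simpa using this)
  exact congrFun this x

theorem exists_left_preadjoint [SMulCommClass ℂ 𝔄 𝔄] (h : IsHLDBA j η) (a : A) (ψ : P) :
    ∃ ψ' : P, ∀ μ, j μ ψ' = j (η a * μ) ψ :=
  IsWeakStarContinuous.exists_preadjoint (f := LinearMap.mulLeft ℂ (η a)) (h.mem_centre a) ψ

theorem exists_right_preadjoint [IsScalarTower ℂ 𝔄 𝔄] (h : IsHLDBA j η) (ν : 𝔄) (ψ : P) :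
    ∃ ψ' : P, ∀ μ, j μ ψ' = j (μ * ν) ψ :=
  IsWeakStarContinuous.exists_preadjoint (f := LinearMap.mulRight ℂ ν)
    (h.mul_right_continuous ν) ψ

/-- The range of `ψ ↦ η^*(ψ̂)` with the norm of the predual. -/
noncomputable def normedSubspace (h : IsHLDBA j η) : NormedSubspace (StrongDual ℂ A) where
  carrier := LinearMap.range (predualPullback j η)
  nrm := (normSeminorm ℂ P).comp
    (LinearEquiv.ofInjective _ h.predualPullback_injective).symm.toLinearMap
  eq_zero_of_nrm φ hφ := by
    have : ‖(LinearEquiv.ofInjective _ h.predualPullback_injective).symm φ‖ = 0 := hφ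
    simpa using this

/-- The predual is isometrically isomorphic to the subspace. -/
noncomputable def predualEquiv (h : IsHLDBA j η) : P ≃ₗᵢ[ℂ] h.normedSubspace.Space where
  toLinearEquiv := LinearEquiv.ofInjective _ h.predualPullback_injective
  norm_map' ψ := by
    change ‖(LinearEquiv.ofInjective _ h.predualPullback_injective).symm
      (LinearEquiv.ofInjective _ h.predualPullback_injective ψ)‖ = ‖ψ‖
    simp

@[simp] theorem incl_predualEquiv (h : IsHLDBA j η) (ψ : P) :
    h.normedSubspace.incl (h.predualEquiv ψ) = predualPullback j η ψ := rfl

theorem elt_eq_predualEquiv (h : IsHLDBA j η) {φ : StrongDual ℂ A}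
    (hφ : φ ∈ h.normedSubspace.carrier) {ψ : P} (hψ : φ = predualPullback j η ψ) :
    h.normedSubspace.elt φ hφ = h.predualEquiv ψ :=
  h.normedSubspace.incl_injective hψ

variable [IsScalarTower ℂ A A] [SMulCommClass ℂ A A]

/-- As `η` is multiplicative, `⟨ψ, η(ab)⟩ = ⟨ψ, η(a) η(b)⟩`: the module action is the preadjoint of
left multiplication by `η(a)`. -/
theorem dualAct_predualPullback (h : IsHLDBA j η) {ψ ψ' : P} {a : A}
    (hψ : ∀ μ, j μ ψ' = j (η a * μ) ψ) :
    dualAct (predualPullback j η ψ) a = predualPullback j η ψ' := by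
  ext b
  simp [hψ, h.map_mul]

variable [SMulCommClass ℂ 𝔄 𝔄]

theorem exists_dualAct_eq (h : IsHLDBA j η) (φ : h.normedSubspace.Space) (a : A) :
    ∃ ψ', (∀ μ, j μ ψ' = j (η a * μ) (h.predualEquiv.symm φ)) ∧
      dualAct (h.normedSubspace.incl φ) a = predualPullback j η ψ' := by
  obtain ⟨ψ', hψ'⟩ := h.exists_left_preadjoint a (h.predualEquiv.symm φ)
  refine ⟨ψ', hψ', ?_⟩
  rw [← h.dualAct_predualPullback hψ', ← h.incl_predualEquiv, LinearIsometryEquiv.apply_symm_apply]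

theorem act_mem (h : IsHLDBA j η) (φ : h.normedSubspace.Space) (a : A) :
    dualAct (h.normedSubspace.incl φ) a ∈ h.normedSubspace.carrier := by
  obtain ⟨ψ', -, h'⟩ := h.exists_dualAct_eq φ a
  exact ⟨ψ', h'.symm⟩

variable [CompleteSpace P]

/-- The range of `ψ ↦ η^*(ψ̂)` as a left homogeneous subspace. -/
noncomputable abbrev homogeneousSubspace (h : IsHLDBA j η) : LeftHomogeneousSubspace A where
  toNormedSubspace := h.normedSubspace
  complete := h.predualEquiv.toIsometryEquiv.completeSpace_iff.1 inferInstance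
  norm_incl_le φ := by
    obtain ⟨ψ, rfl⟩ := h.predualEquiv.surjective φ
    rw [LinearIsometryEquiv.norm_map, incl_predualEquiv]
    refine ContinuousLinearMap.opNorm_le_bound _ (norm_nonneg _) fun a => ?_
    rw [predualPullback_apply, mul_comm]
    exact (norm_predual_apply_le j _ _).trans (by gcongr; exact h.contractive a)
  act_mem := h.act_mem
  norm_act_le φ a := by
    obtain ⟨ψ', hψ', h'⟩ := h.exists_dualAct_eq φ a
    rw [h.elt_eq_predualEquiv _ h', LinearIsometryEquiv.norm_map]
    refine norm_le_of_forall_predual j _ (by positivity) fun μ => ?_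
    rw [hψ']
    have h1 := norm_predual_apply_le j (η a * μ) (h.predualEquiv.symm φ)
    rw [LinearIsometryEquiv.norm_map] at h1
    calc _ ≤ ‖η a * μ‖ * ‖φ‖ := h1
      _ ≤ (‖a‖ * ‖μ‖) * ‖φ‖ := by
        gcongr
        exact (norm_mul_le _ _).trans (by gcongr; exact h.contractive a)
      _ = _ := by ring

theorem act_eq (h : IsHLDBA j η) {ψ ψ' : P} {a : A} (hψ : ∀ μ, j μ ψ' = j (η a * μ) ψ) :
    h.homogeneousSubspace.act (h.predualEquiv ψ) a = h.predualEquiv ψ' :=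
  h.elt_eq_predualEquiv _ (h.dualAct_predualPullback hψ)

/-- `⟨ν □ ψ, a⟩ = ⟨ν, ψ · a⟩ = ⟨η(a) ν, ψ⟩`: the Arens action is the preadjoint of right
multiplication by `ν`. -/
theorem arensAct_eq (h : IsHLDBA j η) {ν : 𝔄} {ψ ψ' : P} (hψ : ∀ μ, j μ ψ' = j (μ * ν) ψ) :
    h.homogeneousSubspace.arensAct (dualCongr h.predualEquiv (j ν)) (h.predualEquiv ψ) =
      predualPullback j η ψ' := by
  ext a
  obtain ⟨ψ'', hψ''⟩ := h.exists_left_preadjoint a ψ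
  rw [LeftHomogeneousSubspace.arensAct_apply, h.act_eq hψ'', predualPullback_apply, hψ, ← hψ'']
  exact congrArg (j ν) (h.predualEquiv.symm_apply_apply _)

variable [IsScalarTower ℂ 𝔄 𝔄]

theorem exists_arensAct_eq (h : IsHLDBA j η) (μ : StrongDual ℂ h.normedSubspace.Space)
    (φ : h.normedSubspace.Space) :
    ∃ ψ', (∀ m, j m ψ' = j (m * j.symm ((dualCongr h.predualEquiv).symm μ))
      (h.predualEquiv.symm φ)) ∧
      h.homogeneousSubspace.arensAct μ φ = predualPullback j η ψ' := by
  obtain ⟨ψ', hψ'⟩ := h.exists_right_preadjoint (j.symm ((dualCongr h.predualEquiv).symm μ))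
    (h.predualEquiv.symm φ)
  refine ⟨ψ', hψ', ?_⟩
  have := h.arensAct_eq hψ'
  rwa [LinearIsometryEquiv.apply_symm_apply, LinearIsometryEquiv.apply_symm_apply,
    LinearIsometryEquiv.apply_symm_apply] at this

/-- The range of `ψ ↦ η^*(ψ̂)` as a left introverted subspace. -/
noncomputable abbrev introvertedSubspace (h : IsHLDBA j η) : LeftIntrovertedSubspace A where
  toLeftHomogeneousSubspace := h.homogeneousSubspace
  arensAct_mem μ φ := by
    obtain ⟨ψ', -, h'⟩ := h.exists_arensAct_eq μ φ
    exact ⟨ψ', h'.symm⟩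
  norm_arensAct_le μ φ := by
    obtain ⟨ψ', hψ', h'⟩ := h.exists_arensAct_eq μ φ
    refine (congrArg norm (h.elt_eq_predualEquiv _ h')).trans_le ?_
    rw [LinearIsometryEquiv.norm_map]
    refine norm_le_of_forall_predual j _ (by positivity) fun m => ?_
    rw [hψ']
    refine (norm_predual_apply_le j _ _).trans ?_
    rw [LinearIsometryEquiv.norm_map]
    calc _ ≤ (‖m‖ * ‖j.symm ((dualCongr h.predualEquiv).symm μ)‖) * ‖φ‖ := by
          gcongr
          exact norm_mul_le _ _
      _ = _ := by
        rw [LinearIsometryEquiv.norm_map, LinearIsometryEquiv.norm_map]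
        ring

theorem box_eq (h : IsHLDBA j η) {ν : 𝔄} {ψ ψ' : P} (hψ : ∀ μ, j μ ψ' = j (μ * ν) ψ) :
    h.introvertedSubspace.box (dualCongr h.predualEquiv (j ν)) (h.predualEquiv ψ) =
      h.predualEquiv ψ' :=
  h.elt_eq_predualEquiv _ (h.arensAct_eq hψ)

/-- The isometric isomorphism of `𝔄` onto the Arens product algebra. -/
noncomputable def arensEquiv (h : IsHLDBA j η) : 𝔄 ≃ₗᵢ[ℂ] h.introvertedSubspace.ArensAlgebra :=
  j.trans ((dualCongr h.predualEquiv).trans h.introvertedSubspace.predual.symm)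

theorem predual_arensEquiv (h : IsHLDBA j η) (μ : 𝔄) :
    h.introvertedSubspace.predual (h.arensEquiv μ) = dualCongr h.predualEquiv (j μ) := rfl

theorem predual_arensEquiv_apply (h : IsHLDBA j η) (μ : 𝔄) (φ : h.introvertedSubspace.Space) :
    h.introvertedSubspace.predual (h.arensEquiv μ) φ = j μ (h.predualEquiv.symm φ) := rfl

theorem arensEquiv_mul (h : IsHLDBA j η) (μ ν : 𝔄) :
    h.arensEquiv (μ * ν) = h.arensEquiv μ * h.arensEquiv ν := by
  apply h.introvertedSubspace.predual.injective
  ext φ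
  obtain ⟨ψ, rfl⟩ := h.predualEquiv.surjective φ
  obtain ⟨ψ', hψ'⟩ := h.exists_right_preadjoint ν ψ
  rw [LeftIntrovertedSubspace.predual_mul, predual_arensEquiv h ν, h.box_eq hψ',
    predual_arensEquiv_apply, predual_arensEquiv_apply]
  rw [LinearIsometryEquiv.symm_apply_apply, LinearIsometryEquiv.symm_apply_apply]
  exact (hψ' μ).symm

theorem isWeakStarContinuous_arensEquiv (h : IsHLDBA j η) :
    IsWeakStarContinuous j h.introvertedSubspace.predual h.arensEquiv :=
  isWeakStarContinuous_of_preadjoint h.predualEquiv.symm h.predual_arensEquiv_apply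

theorem arensEquiv_eta (h : IsHLDBA j η) (a : A) :
    h.arensEquiv (η a) = h.introvertedSubspace.eta a := by
  apply h.introvertedSubspace.predual.injective
  ext φ
  obtain ⟨ψ, rfl⟩ := h.predualEquiv.surjective φ
  rw [LeftIntrovertedSubspace.predual_eta, predual_arensEquiv_apply]
  rw [LinearIsometryEquiv.symm_apply_apply]
  rfl

theorem hldbaEquivalent (h : IsHLDBA j η) :
    HLDBAEquivalent j η h.introvertedSubspace.predual h.introvertedSubspace.eta :=
  ⟨h.arensEquiv, h.arensEquiv_mul, h.isWeakStarContinuous_arensEquiv, h.arensEquiv_eta⟩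

theorem eq_predualEquiv (h : IsHLDBA j η) {φ : h.introvertedSubspace.Space} {ψ : P}
    (hφ : h.introvertedSubspace.incl φ = predualPullback j η ψ) : φ = h.predualEquiv ψ :=
  h.normedSubspace.incl_injective hφ

end IsHLDBA

end Construction

/-! ### Uniqueness -/

section Uniqueness

/-- Only the carrier and the norm are data; the norms are compared through `E` because the two
carriers are a priori different types. -/
theorem NormedSubspace.eq_of_norm_eq {E : Type*} [AddCommGroup E] [Module ℂ E]
    {S T : NormedSubspace E} (hc : S.carrier = T.carrier)
    (hn : ∀ (φ : S.Space) (φ' : T.Space), S.incl φ = T.incl φ' → ‖φ‖ = ‖φ'‖) : S = T := by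
  obtain ⟨C, p, hp⟩ := S
  obtain ⟨C', p', hp'⟩ := T
  dsimp only at hc
  subst hc
  have : p = p' := Seminorm.ext fun φ => hn φ φ rfl
  subst this
  rfl

variable {A 𝔄 P : Type*} [NonUnitalNormedRing A] [NormedSpace ℂ A] [IsScalarTower ℂ A A]
  [SMulCommClass ℂ A A] [NonUnitalNormedRing 𝔄] [NormedSpace ℂ 𝔄] [NormedAddCommGroup P]
  [NormedSpace ℂ P] {j : 𝔄 ≃ₗᵢ[ℂ] StrongDual ℂ P} {η : A →L[ℂ] 𝔄}

theorem LeftIntrovertedSubspace.eq_of_norm_eq {S T : LeftIntrovertedSubspace A}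
    (hc : S.carrier = T.carrier)
    (hn : ∀ (φ : S.Space) (φ' : T.Space), S.incl φ = T.incl φ' → ‖φ‖ = ‖φ'‖) : S = T := by
  have h := NormedSubspace.eq_of_norm_eq hc hn
  obtain ⟨⟨S, _⟩, _⟩ := S
  obtain ⟨⟨T, _⟩, _⟩ := T
  dsimp only at h
  subst h
  rfl

theorem OperatorLeftIntrovertedSubspace.eq_of_mnorm_eq {OA : OperatorSpaceStructure A}
    {S T : OperatorLeftIntrovertedSubspace OA} (hc : S.carrier = T.carrier)
    (hn : ∀ (n : ℕ) (φ : Matrix (Fin n) (Fin n) S.Space) (φ' : Matrix (Fin n) (Fin n) T.Space),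
      φ.map S.incl = φ'.map T.incl → S.OS.mnorm n φ = T.OS.mnorm n φ') : S = T := by
  have h : S.toLeftIntrovertedSubspace = T.toLeftIntrovertedSubspace :=
    LeftIntrovertedSubspace.eq_of_norm_eq hc fun φ φ' hφ => by
      rw [← S.OS.norm_one, ← T.OS.norm_one]
      exact hn 1 _ _ (by ext1 i k; exact hφ)
  obtain ⟨S, OS, _⟩ := S
  obtain ⟨T, OT, _⟩ := T
  dsimp only at h
  subst h
  have : OS = OT := by
    obtain ⟨m, _⟩ := OS
    obtain ⟨m', _⟩ := OT
    have : m = m' := funext fun n => Seminorm.ext fun φ => hn n φ φ rfl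
    subst this
    rfl
  subst this
  rfl

/-- An equivalence with an Arens product algebra identifies the introverted subspace with the
predual. -/
theorem LeftIntrovertedSubspace.exists_predual_equiv (T : LeftIntrovertedSubspace A)
    {Φ : 𝔄 ≃ₗᵢ[ℂ] T.ArensAlgebra} (hΦ : IsWeakStarContinuous j T.predual Φ)
    (hη : ∀ a, Φ (η a) = T.eta a) :
    ∃ ρ : T.Space ≃ₗᵢ[ℂ] P, (∀ μ φ, j μ (ρ φ) = T.predual (Φ μ) φ) ∧
      ∀ φ, predualPullback j η (ρ φ) = T.incl φ := by
  have := T.complete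
  obtain ⟨ρ, hρ⟩ := hΦ.exists_predual_equiv
  refine ⟨ρ, hρ, fun φ => ?_⟩
  ext a
  -- `⟨η(a), ρ φ⟩ = ⟨Φ(η(a)), φ⟩ = ⟨η_T(a), φ⟩ = φ(a)`.
  rw [predualPullback_apply, hρ, hη, LeftIntrovertedSubspace.predual_eta]

theorem LeftIntrovertedSubspace.carrier_eq_range (T : LeftIntrovertedSubspace A)
    (ρ : T.Space ≃ₗᵢ[ℂ] P) (hρ : ∀ φ, predualPullback j η (ρ φ) = T.incl φ) :
    T.carrier = LinearMap.range (predualPullback j η) := by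
  refine le_antisymm (fun φ hφ => ⟨ρ (T.elt φ hφ), hρ _⟩) ?_
  rintro _ ⟨ψ, rfl⟩
  obtain ⟨φ, rfl⟩ := ρ.surjective ψ
  rw [hρ]
  exact T.incl_mem φ

end Uniqueness

/-! ### The operator space version -/

section OperatorVersion

open scoped Matrix.Norms.L2Operator

/-! ### Transport of operator space structures -/

section Transport

variable {V W : Type*} [NormedAddCommGroup V] [NormedSpace ℂ V] [NormedAddCommGroup W]
  [NormedSpace ℂ W]

/-- The operator space structure transported along an isometric isomorphism. -/
noncomputable def OperatorSpaceStructure.transport (O : OperatorSpaceStructure V)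
    (e : V ≃ₗᵢ[ℂ] W) : OperatorSpaceStructure W where
  mnorm n := (O.mnorm n).comp (e.symm.toLinearEquiv : W →ₗ[ℂ] V).mapMatrix
  norm_one v := by
    rw [← e.symm.norm_map v, ← O.norm_one]
    rfl
  direct_sum m n v w := by
    refine Eq.trans ?_ (O.direct_sum m n (v.map e.symm) (w.map e.symm))
    refine congrArg (O.mnorm (m + n)) ?_
    rw [matrixDirectSum, matrixDirectSum, Matrix.reindex_apply, Matrix.reindex_apply,
      LinearMap.mapMatrix_apply, ← Matrix.submatrix_map, Matrix.fromBlocks_map]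
    congr 2 <;> ext <;> simp
  two_sided_le m n α v β := by
    refine le_trans (le_of_eq ?_) (O.two_sided_le m n α (v.map e.symm) β)
    refine congrArg (O.mnorm n) ?_
    ext i k
    simp [scalarTwoSided]

theorem OperatorSpaceStructure.transport_norms (O : OperatorSpaceStructure V) (e : V ≃ₗᵢ[ℂ] W)
    {n : ℕ} (w : Matrix (Fin n) (Fin n) W) :
    (O.transport e).norms n w = O.norms n (w.map e.symm) := rfl

/-- The test matrices over `W` are exactly the images of those over `V`, with equal norms, so both
infima run over the same constants. -/
theorem OperatorSpaceStructure.dualNorms_transport (O : OperatorSpaceStructure V)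
    (e : V ≃ₗᵢ[ℂ] W) {n : ℕ} (f : Matrix (Fin n) (Fin n) (StrongDual ℂ V)) :
    dualNorms (O.transport e).norms n (f.map (dualCongr e)) = dualNorms O.norms n f := by
  unfold dualNorms
  congr 1
  ext C
  refine and_congr_right fun _ => forall_congr' fun m => ⟨fun h v => ?_, fun h w => ?_⟩
  · have := h (v.map e)
    have e1 : (v.map e).map e.symm = v := by ext; simp
    rw [O.transport_norms, e1] at this
    simpa [dualCongr_apply] using this
  · exact h (w.map e.symm)

end Transport

/-! ### Matrix norms of a predual computed from its dual -/

section Norming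

variable {E P : Type*} [NormedAddCommGroup E] [NormedSpace ℂ E] [NormedAddCommGroup P]
  [NormedSpace ℂ P] {OE : OperatorSpaceStructure E} {OP : OperatorSpaceStructure P}
  {j : E ≃ₗᵢ[ℂ] StrongDual ℂ P}

theorem norm_predual_pairing_le (hj : IsCompleteIsometry OE.norms (dualNorms OP.norms) j)
    {n m : ℕ} (μ : Matrix (Fin n) (Fin n) E) (ψ : Matrix (Fin m) (Fin m) P) :
    ‖matrixPairing (μ.map j) ψ‖ ≤ OE.norms n μ * OP.norms m ψ := by
  rw [← hj]
  exact OP.norm_matrixPairing_le _ _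

theorem norms_le_of_forall_predual (hj : IsCompleteIsometry OE.norms (dualNorms OP.norms) j)
    {n : ℕ} (ψ : Matrix (Fin n) (Fin n) P) {C : ℝ} (hC : 0 ≤ C)
    (h : ∀ (m : ℕ) (μ : Matrix (Fin m) (Fin m) E),
      ‖matrixPairing (μ.map j) ψ‖ ≤ OE.norms m μ * C) : OP.norms n ψ ≤ C := by
  refine OP.norms_le_of_forall_dual ψ hC fun m f => ?_
  have := h m (f.map j.symm)
  have e : (f.map j.symm).map j = f := by ext1; simp
  rwa [← hj, e] at this

/-- A matrix over the predual is dominated by another one if its pairings are pairings of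
the other one, up to a permutation of the indices. -/
theorem norms_le_of_pairing_eq (hj : IsCompleteIsometry OE.norms (dualNorms OP.norms) j)
    {n p : ℕ} (θ : Matrix (Fin n) (Fin n) P) (ψ : Matrix (Fin p) (Fin p) P) {C : ℝ} (hC : 0 ≤ C)
    (h : ∀ (m : ℕ) (μ : Matrix (Fin m) (Fin m) E), ∃ (r : ℕ) (ν : Matrix (Fin r) (Fin r) E)
      (e : Fin m × Fin n ≃ Fin r × Fin p), OE.norms r ν ≤ OE.norms m μ * C ∧
      ∀ s t, j (μ s.1 t.1) (θ s.2 t.2) = j (ν (e s).1 (e t).1) (ψ (e s).2 (e t).2)) :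
    OP.norms n θ ≤ C * OP.norms p ψ := by
  have hψ : 0 ≤ OP.norms p ψ := apply_nonneg (OP.mnorm p) ψ
  refine norms_le_of_forall_predual hj θ (by positivity) fun m μ => ?_
  obtain ⟨r, ν, e, hν, he⟩ := h m μ
  have e1 : matrixPairing (μ.map j) θ = (matrixPairing (ν.map j) ψ).submatrix e e := by
    ext s t
    exact he s t
  rw [e1, l2_opNorm_submatrix, ← mul_assoc]
  exact (norm_predual_pairing_le hj ν ψ).trans (mul_le_mul_of_nonneg_right hν hψ)

end Norming

/-! ### Complete isometry and the operator Arens product algebra -/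

variable {A 𝔄 P : Type*} [NonUnitalNormedRing A] [NormedSpace ℂ A] [IsScalarTower ℂ A A]
  [SMulCommClass ℂ A A] [NonUnitalNormedRing 𝔄] [NormedSpace ℂ 𝔄] [NormedAddCommGroup P]
  [NormedSpace ℂ P] {j : 𝔄 ≃ₗᵢ[ℂ] StrongDual ℂ P} {η : A →L[ℂ] 𝔄} {OA : OperatorSpaceStructure A}
  {O𝔄 : OperatorSpaceStructure 𝔄} {OP : OperatorSpaceStructure P}

/-- The identification of an introverted subspace with the predual that comes from a completely
isometric equivalence is completely isometric. -/
theorem OperatorLeftIntrovertedSubspace.norms_predual_equiv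
    (T : OperatorLeftIntrovertedSubspace OA)
    (hj : IsCompleteIsometry O𝔄.norms (dualNorms OP.norms) j) {Φ : 𝔄 ≃ₗᵢ[ℂ] T.ArensAlgebra}
    (hΦ : IsCompleteIsometry O𝔄.norms T.algebraNorms Φ) (ρ : T.Space ≃ₗᵢ[ℂ] P)
    (hρ : ∀ μ φ, j μ (ρ φ) = T.predual (Φ μ) φ) {n : ℕ} (φ : Matrix (Fin n) (Fin n) T.Space) :
    OP.norms n (φ.map ρ) = T.OS.norms n φ := by
  -- Through `j` and through `Φ`, `𝔄` is the complete dual of both `P` and `T`. Corresponding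
  -- matrices have equal pairings with `𝔄`, so recovering norms from the dual gives both
  -- inequalities.
  have hk : IsCompleteIsometry O𝔄.norms (dualNorms T.OS.norms) (Φ.trans T.predual) :=
    fun n μ => hΦ n μ
  have e : ∀ (m : ℕ) (μ : Matrix (Fin m) (Fin m) 𝔄),
      matrixPairing (μ.map j) (φ.map ρ) = matrixPairing (μ.map (Φ.trans T.predual)) φ :=
    fun m μ => by
      ext s t
      exact hρ _ _
  refine le_antisymm (norms_le_of_forall_predual hj _ (apply_nonneg (T.OS.mnorm n) _)
    fun m μ => ?_) (norms_le_of_forall_predual hk _ (apply_nonneg (OP.mnorm n) _) fun m μ => ?_)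
  · rw [e]
    exact norm_predual_pairing_le hk μ φ
  · rw [← e]
    exact norm_predual_pairing_le hj μ _

variable [IsScalarTower ℂ 𝔄 𝔄] [SMulCommClass ℂ 𝔄 𝔄] [CompleteSpace P]

theorem IsHLDBA.predual_symm_act (h : IsHLDBA j η) (φ : h.introvertedSubspace.Space) (a : A)
    (μ : 𝔄) : j μ (h.predualEquiv.symm (h.introvertedSubspace.act φ a)) =
      j (η a * μ) (h.predualEquiv.symm φ) := by
  obtain ⟨ψ', hψ', h'⟩ := h.exists_dualAct_eq φ a
  have e : h.introvertedSubspace.act φ a = h.predualEquiv ψ' := h.elt_eq_predualEquiv _ h'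
  rw [e, LinearIsometryEquiv.symm_apply_apply, hψ']

theorem IsHLDBA.predual_symm_box (h : IsHLDBA j η)
    (μ : StrongDual ℂ h.introvertedSubspace.Space) (φ : h.introvertedSubspace.Space) (m : 𝔄) :
    j m (h.predualEquiv.symm (h.introvertedSubspace.box μ φ)) =
      j (m * j.symm ((dualCongr h.predualEquiv).symm μ)) (h.predualEquiv.symm φ) := by
  obtain ⟨ψ', hψ', h'⟩ := h.exists_arensAct_eq μ φ
  have e : h.introvertedSubspace.box μ φ = h.predualEquiv ψ' := h.elt_eq_predualEquiv _ h'
  rw [e, LinearIsometryEquiv.symm_apply_apply, hψ']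

namespace IsOperatorHLDBA

theorem dualNorms_transport_eq (h : IsOperatorHLDBA OA O𝔄 OP j η) {n : ℕ}
    (f : Matrix (Fin n) (Fin n) (StrongDual ℂ h.introvertedSubspace.Space)) :
    dualNorms (OP.transport h.predualEquiv).norms n f =
      O𝔄.norms n (f.map fun μ => j.symm ((dualCongr h.predualEquiv).symm μ)) := by
  rw [← h.predual, ← OP.dualNorms_transport h.predualEquiv]
  congr 1
  ext1 i k
  simp

/-- The range of `ψ ↦ η^*(ψ̂)` as an operator left introverted subspace. -/
noncomputable def introvertedSubspace (h : IsOperatorHLDBA OA O𝔄 OP j η) :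
    OperatorLeftIntrovertedSubspace OA where
  toLeftIntrovertedSubspace := h.toIsHLDBA.introvertedSubspace
  OS := OP.transport h.predualEquiv
  cc_incl n φ := by
    rw [OP.transport_norms]
    refine dualNorms_le _ _ (apply_nonneg (OP.mnorm n) _) fun m a => ?_
    have h1 := norm_predual_pairing_le h.predual (a.map η) (φ.map h.predualEquiv.symm)
    -- Evaluating `φ` on `a` is pairing `η(a)` with the predual matrix, with the two index factors
    -- exchanged.
    have e : matrixPairing (φ.map h.toIsHLDBA.introvertedSubspace.incl) a =
        (matrixPairing ((a.map η).map j) (φ.map h.predualEquiv.symm)).submatrix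
          (Equiv.prodComm _ _) (Equiv.prodComm _ _) := by
      ext s t
      have := h.incl_predualEquiv (h.predualEquiv.symm (φ s.1 t.1))
      rw [LinearIsometryEquiv.apply_symm_apply] at this
      exact congrArg (fun f : StrongDual ℂ A => f (a s.2 t.2)) this
    rw [e, l2_opNorm_submatrix, mul_comm]
    exact h1.trans (mul_le_mul_of_nonneg_right (h.completely_contractive m a)
      (apply_nonneg (OP.mnorm n) _))
  cc_act p q φ a := by
    rw [OP.transport_norms, OP.transport_norms, mul_comm (OP.norms p _)]
    refine norms_le_of_pairing_eq h.predual _ _ (apply_nonneg (OA.mnorm q) a) fun m μ => ?_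
    -- Pairing `μ` with `[φ · a]` is pairing the product matrix `[η(a) μ]` with `φ`. The index `(i,
    -- (k, l))` becomes `((l, i), k)`, since `η(a)` multiplies from the left.
    refine ⟨q * m, _, ((Equiv.prodCongr (.refl _) (finProdFinEquiv.symm.trans
      (Equiv.prodComm _ _))).trans (Equiv.prodAssoc _ _ _).symm).trans (Equiv.prodCongr
        ((Equiv.prodComm _ _).trans finProdFinEquiv) (.refl _)),
      (h.cc_algebra q m (a.map η) μ).trans ?_, fun s t => ?_⟩
    · rw [mul_comm]
      exact mul_le_mul_of_nonneg_left (h.completely_contractive q a) (apply_nonneg (O𝔄.mnorm m) _)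
    · simpa using h.predual_symm_act _ _ _
  cc_box p q f φ := by
    rw [OP.transport_norms, OP.transport_norms, h.dualNorms_transport_eq]
    refine norms_le_of_pairing_eq h.predual _ _ (apply_nonneg (O𝔄.mnorm p) _) fun m μ => ?_
    -- The element of `𝔄` behind `f` multiplies `μ` from the right, so reassociating the indices
    -- suffices.
    refine ⟨m * p, _, ((Equiv.prodCongr (.refl _) finProdFinEquiv.symm).trans
      (Equiv.prodAssoc _ _ _).symm).trans (Equiv.prodCongr finProdFinEquiv (.refl _)),
      h.cc_algebra m p μ _, fun s t => ?_⟩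
    simpa using h.predual_symm_box _ _ _

theorem operatorHLDBAEquivalent (h : IsOperatorHLDBA OA O𝔄 OP j η) :
    OperatorHLDBAEquivalent O𝔄.norms j η h.introvertedSubspace.algebraNorms
      h.introvertedSubspace.predual h.introvertedSubspace.eta := by
  refine ⟨h.arensEquiv, h.arensEquiv_mul, h.isWeakStarContinuous_arensEquiv, h.arensEquiv_eta,
    fun n μ => ?_⟩
  rw [← h.predual]
  exact OP.dualNorms_transport h.predualEquiv (μ.map j)

end IsOperatorHLDBA

end OperatorVersion

theorem mainTheorem1 {A 𝔄 P : Type*}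
    [NonUnitalNormedRing A] [NormedSpace ℂ A] [IsScalarTower ℂ A A] [SMulCommClass ℂ A A]
    [CompleteSpace A]
    [NonUnitalNormedRing 𝔄] [NormedSpace ℂ 𝔄] [IsScalarTower ℂ 𝔄 𝔄] [SMulCommClass ℂ 𝔄 𝔄]
    [CompleteSpace 𝔄]
    [NormedAddCommGroup P] [NormedSpace ℂ P] [CompleteSpace P]
    (j : 𝔄 ≃ₗᵢ[ℂ] StrongDual ℂ P) (η : A →L[ℂ] 𝔄) :
    (IsHLDBA j η →
      ∃ S : LeftIntrovertedSubspace A,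
        HLDBAEquivalent j η S.predual S.eta ∧
        (∀ T : LeftIntrovertedSubspace A, HLDBAEquivalent j η T.predual T.eta → T = S) ∧
        S.carrier = LinearMap.range (predualPullback j η) ∧
        ∀ (ψ : P) (φ : S.Space), S.incl φ = predualPullback j η ψ → ‖φ‖ = ‖ψ‖) ∧
    (∀ (OA : OperatorSpaceStructure A) (O𝔄 : OperatorSpaceStructure 𝔄)
        (OP : OperatorSpaceStructure P),
      IsCCBanachAlgebra OA → IsOperatorHLDBA OA O𝔄 OP j η →
      ∃ S : OperatorLeftIntrovertedSubspace OA,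
        OperatorHLDBAEquivalent O𝔄.norms j η S.algebraNorms S.predual S.eta ∧
        (∀ T : OperatorLeftIntrovertedSubspace OA,
          OperatorHLDBAEquivalent O𝔄.norms j η T.algebraNorms T.predual T.eta → T = S) ∧
        S.carrier = LinearMap.range (predualPullback j η) ∧
        ∀ (n : ℕ) (ψ : Matrix (Fin n) (Fin n) P) (φ : Matrix (Fin n) (Fin n) S.Space),
          φ.map S.incl = ψ.map (predualPullback j η) →
            S.OS.mnorm n φ = OP.mnorm n ψ) := by
  refine ⟨fun h => ⟨h.introvertedSubspace, h.hldbaEquivalent, ?_, rfl, fun ψ φ hφ => ?_⟩,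
    fun OA O𝔄 OP _ h => ⟨h.introvertedSubspace, h.operatorHLDBAEquivalent, ?_, rfl,
      fun n ψ φ hφ => ?_⟩⟩
  · rintro T ⟨Φ, -, hΦ, hη⟩
    obtain ⟨ρ, -, hρ⟩ := T.exists_predual_equiv hΦ hη
    refine LeftIntrovertedSubspace.eq_of_norm_eq (T.carrier_eq_range ρ hρ) fun φ φ' hφ => ?_
    -- Both norms are the norm of the same element `ρ φ` of `P`.
    rw [h.eq_predualEquiv (hφ.symm.trans (hρ φ).symm), LinearIsometryEquiv.norm_map,
      LinearIsometryEquiv.norm_map]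
  · rw [h.eq_predualEquiv hφ, LinearIsometryEquiv.norm_map]
  · rintro T ⟨Φ, -, hΦ, hη, hc⟩
    obtain ⟨ρ, hρΦ, hρ⟩ := T.exists_predual_equiv hΦ hη
    refine OperatorLeftIntrovertedSubspace.eq_of_mnorm_eq (T.carrier_eq_range ρ hρ)
      fun n φ φ' hφ => ?_
    refine (T.norms_predual_equiv h.predual hc ρ hρΦ φ).symm.trans ?_
    refine congrArg (OP.mnorm n) ?_
    ext1 i k
    have e := h.eq_predualEquiv ((congrFun (congrFun hφ i) k).symm.trans (hρ (φ i k)).symm)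
    exact (h.predualEquiv.symm_apply_eq.2 e).symm
  · refine congrArg (OP.mnorm n) ?_
    ext1 i k
    exact h.predualEquiv.symm_apply_eq.2 (h.eq_predualEquiv (congrFun (congrFun hφ i) k))
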